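/- Let $\mathcal S\subset\mathbb R^{m}$ and $\mathcal A\subset\mathbb R^{n}$ be bounded convex Borel sets of positive Lebesgue measure, $d=m+n$, and equip $\mathcal S\times\mathcal A\subset\mathbb R^d$ with the $\ell^q$ product metric $\rho$ of the Euclidean metrics of $\mathcal S$ and $\mathcal A$, for some $q\in[1,\infty]$ (for example $q=1$: $|s-\hat s|+|a-\hat a|$, or $q=2$: the Euclidean metric); $\mathrm{diam}(\mathcal S\times\mathcal A)$ is taken in $\rho$. Consider an entropy-regularized MDP $\langle\mathcal S,\mathcal A,p,r,\gamma,\beta,\pi_0\rangle$ with stochastic dynamics $p(\cdot\,|\,s,a)$, discount factor $\gamma\in[0,1)$, inverse temperature $\beta>0$, rewards $r(s,a)\in[R_{\min},R_{\max}]$ and a prior policy with positive density $\pi_0(a|s)$ with respect to Lebesgue measure on $\mathcal A$. Put $H=(1-\gamma)^{-1}$. Let $$Q^*(s,a)=\sup_\pi\Big\{r(s,a)+\mathbb E_\pi\Big[\sum_{t\ge1}\gamma^t\Big(r(s_t,a_t)-\tfrac1\beta\log\tfrac{\pi(a_t|s_t)}{\pi_0(a_t|s_t)}\Big)\,\Big|\,s_0=s,a_0=a\Big]\Big\}$$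 be the optimal soft action-value function, the supremum being over policies with a density and finite expected return. Assume that $r$ is $L_r$-Lipschitz for $\rho$, that $(s,a)\mapsto p(\cdot\,|\,s,a)$ is $L_p$-Lipschitz from $\rho$ to the 1-Wasserstein (Kantorovich) distance, and that $\log\pi_0(a|s)$ is $L_\kappa$-Lipschitz in $s$ for every $a$. Let $Q:\mathcal S\times\mathcal A\to\mathbb R$ be $L_Q$-Lipschitz for $\rho$ with $\sup Q-\inf Q\le H(R_{\max}-R_{\min})$, and put $L_\Delta=L_r+L_Q+\gamma L_p(L_Q+\beta^{-1}L_\kappa)$. Let $\varepsilon_i,\delta_i>0$ ($i=1,2,3$) and let $|\mathcal B|,n_{\mathcal S},n_{\mathcal A}\ge1$ be integers with $$|\mathcal B|\ge\Big(\frac{L_\Delta\,\mathrm{diam}(\mathcal S\times\mathcal A)}{\varepsilon_1}\Big)^{d}\log\frac1{\delta_1},\qquad n_{\mathcal S}\ge\frac12\Big(\frac{H(R_{\max}-R_{\min})}{\varepsilon_2}\Big)^2\log\frac2{\delta_2},\qquad n_{\mathcal A}\ge\frac12\Big(\frac{e^{\beta H(R_{\max}-R_{\min})}-1}{e^{\beta\varepsilon_3}-1}\Big)^2\log\frac2{\delta_3}.$$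 Draw a batch $\mathcal B$ of $|\mathcal B|$ independent pairs, $s\sim\mathrm{Unif}(\mathcal S)$ and $a\sim\mathrm{Unif}(\mathcal A)$ independently. At a fixed pair $(s,a)$ of interest and, independently, at each pair of the batch, draw $n_{\mathcal S}$ independent next states $s'_i\sim p(\cdot\,|\,s,a)$ and, for each of them, $n_{\mathcal A}$ independent actions $a_{ij}\sim\pi_0(\cdot\,|\,s'_i)$. Put $$\hat V(s'_i)=\frac1\beta\log\frac1{n_{\mathcal A}}\sum_{j=1}^{n_{\mathcal A}}e^{\beta Q(s'_i,a_{ij})},\qquad\hat\Delta(s,a)=r(s,a)+\gamma\,\frac1{n_{\mathcal S}}\sum_{i=1}^{n_{\mathcal S}}\hat V(s'_i)-Q(s,a).$$ Then, for every $(s,a)\in\mathcal S\times\mathcal A$, with probability at least $1-\delta_1-2\delta_2-2\delta_3$ both of the following bounds hold: $$Q^*(s,a)\le r(s,a)+\gamma\Big(\frac1{n_{\mathcal S}}\sum_{i=1}^{n_{\mathcal S}}\hat V(s'_i)+\frac{\max_{\mathcal B}\hat\Delta+\varepsilon_1+\varepsilon_2+\varepsilon_3}{1-\gamma}\Big),$$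 $$Q^*(s,a)\ge r(s,a)+\gamma\Big(\frac1{n_{\mathcal S}}\sum_{i=1}^{n_{\mathcal S}}\hat V(s'_i)+\frac{\min_{\mathcal B}\hat\Delta-\varepsilon_1-\varepsilon_2-\varepsilon_3}{1-\gamma}\Big).$$ -/

import Mathlib

open MeasureTheory ProbabilityTheory
open scoped ENNReal

noncomputable section

namespace SoftRL

/-- A bounded convex domain of `ℝ^k` with positive Lebesgue measure (a "bounded continuous space"). -/
structure Domain (k : ℕ) where
  carrier : Set (EuclideanSpace ℝ (Fin k))
  isBounded : Bornology.IsBounded carrier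
  convex : Convex ℝ carrier
  measurableSet : MeasurableSet carrier
  volume_ne_zero : volume carrier ≠ 0

variable {m n : ℕ}

/-- The points of a domain, as a type (with the Euclidean metric and the Borel σ-algebra). -/
abbrev Domain.Pt {k : ℕ} (D : Domain k) : Type := ↥D.carrier

/-- Lebesgue measure on a domain. -/
def Domain.lebesgue {k : ℕ} (D : Domain k) : Measure D.Pt :=
  Measure.comap Subtype.val (volume : Measure (EuclideanSpace ℝ (Fin k)))

instance {k : ℕ} (D : Domain k) : IsFiniteMeasure D.lebesgue := by
  constructor
  rw [Domain.lebesgue, comap_subtype_coe_apply D.measurableSet]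
  simpa using D.isBounded.measure_lt_top

/-- The uniform distribution on a domain: normalized Lebesgue measure. -/
def Domain.unif {k : ℕ} (D : Domain k) : Measure D.Pt :=
  (D.lebesgue Set.univ)⁻¹ • D.lebesgue

instance {k : ℕ} (D : Domain k) : IsProbabilityMeasure D.unif := by
  have h : D.lebesgue Set.univ ≠ 0 := by
    rw [Domain.lebesgue, comap_subtype_coe_apply D.measurableSet]
    simpa using D.volume_ne_zero
  constructor
  simp [Domain.unif, ENNReal.inv_mul_cancel h (measure_ne_top _ _)]

/-- The `ℓ^q` product distance on `S × A ⊆ ℝ^m × ℝ^n`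
(`q = 1`: `|s - s'| + |a - a'|`; `q = 2`: the Euclidean distance of `ℝ^(m+n)`). -/
def saDist (q : ℝ≥0∞) [Fact (1 ≤ q)] {S : Domain m} {A : Domain n} (x y : S.Pt × A.Pt) : ℝ :=
  dist (WithLp.toLp q ((x.1 : EuclideanSpace ℝ (Fin m)), (x.2 : EuclideanSpace ℝ (Fin n))))
    (WithLp.toLp q ((y.1 : EuclideanSpace ℝ (Fin m)), (y.2 : EuclideanSpace ℝ (Fin n))))

/-- The diameter of `S × A` for the distance `saDist q`. -/
def saDiam (q : ℝ≥0∞) [Fact (1 ≤ q)] (S : Domain m) (A : Domain n) : ℝ :=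
  Metric.diam (Set.range fun x : S.Pt × A.Pt =>
    WithLp.toLp q ((x.1 : EuclideanSpace ℝ (Fin m)), (x.2 : EuclideanSpace ℝ (Fin n))))

/-- A stochastic policy `π(a|s)`, given by its probability density with respect to
Lebesgue measure on the action space. -/
structure Policy (S : Domain m) (A : Domain n) where
  density : S.Pt → A.Pt → ℝ
  measurable : Measurable (Function.uncurry density)
  nonneg : ∀ s a, 0 ≤ density s a
  integral_eq_one : ∀ s, ∫ a, density s a ∂A.lebesgue = 1

variable {S : Domain m} {A : Domain n}

/-- The Markov kernel `s ↦ π(a|s) da` of a policy. -/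
def Policy.kernel (π : Policy S A) : Kernel S.Pt A.Pt :=
  Kernel.withDensity (Kernel.const S.Pt A.lebesgue) fun s a => ENNReal.ofReal (π.density s a)

instance (π : Policy S A) : IsMarkovKernel π.kernel := by
  constructor
  intro s
  constructor
  rw [Policy.kernel, Kernel.withDensity_apply' _ (by have := π.measurable; fun_prop)]
  have hi : Integrable (π.density s) A.lebesgue :=
    .of_integral_ne_zero (by rw [π.integral_eq_one s]; exact one_ne_zero)
  rw [Kernel.const_apply, setLIntegral_univ, ← ofReal_integral_eq_lintegral_ofReal hi
    (.of_forall (π.nonneg s)), π.integral_eq_one s, ENNReal.ofReal_one]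

/-- An entropy-regularized Markov decision process `⟨S, A, p, r, γ, β, π₀⟩` with stochastic dynamics.
The prior policy has a positive density, so that `log π₀` is finite. -/
structure MDP (S : Domain m) (A : Domain n) where
  /-- the dynamics `p(s'|s,a)` -/
  trans : Kernel (S.Pt × A.Pt) S.Pt
  [isMarkov : IsMarkovKernel trans]
  /-- the reward function `r(s,a)` -/
  reward : S.Pt × A.Pt → ℝ
  /-- the discount factor `γ` -/
  disc : ℝ
  disc_nonneg : 0 ≤ disc
  disc_lt_one : disc < 1
  /-- the inverse temperature `β` -/
  beta : ℝ
  beta_pos : 0 < beta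
  /-- the prior policy `π₀` -/
  prior : Policy S A
  prior_pos : ∀ s a, 0 < prior.density s a

attribute [instance] MDP.isMarkov

namespace MDP

variable (M : MDP S A)

/-- The effective horizon `H = (1 - γ)⁻¹`. -/
def horizon : ℝ := (1 - M.disc)⁻¹

/-! ### The optimal soft action-value function -/

/-- One step of the state-action process under `π`: `s' ∼ p(·|s,a)`, then `a' ∼ π(·|s')`. -/
def step (π : Policy S A) : Kernel (S.Pt × A.Pt) (S.Pt × A.Pt) :=
  M.trans ⊗ₖ Kernel.prodMkLeft (S.Pt × A.Pt) π.kernel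

/-- The law of `(s_t, a_t)` under `π`, given `(s_0, a_0)`. -/
def saLaw (π : Policy S A) : ℕ → Kernel (S.Pt × A.Pt) (S.Pt × A.Pt)
  | 0 => Kernel.id
  | t + 1 => M.step π ∘ₖ saLaw π t

/-- The regularized reward `r(s,a) - β⁻¹ log (π(a|s) / π₀(a|s))`. -/
def regReward (π : Policy S A) (x : S.Pt × A.Pt) : ℝ :=
  M.reward x - M.beta⁻¹ * Real.log (π.density x.1 x.2 / M.prior.density x.1 x.2)

/-- The policy `π` has a well-defined finite regularized return from `x = (s_0, a_0)`
(otherwise its entropic cost is infinite and its return is `-∞`). -/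
def FiniteReturn (π : Policy S A) (x : S.Pt × A.Pt) : Prop :=
  (∀ t : ℕ, Integrable (M.regReward π) (M.saLaw π (t + 1) x)) ∧
    Summable fun t : ℕ => M.disc ^ (t + 1) * ∫ y, |M.regReward π y| ∂M.saLaw π (t + 1) x

/-- The soft action-value of `π`: the given first action `a_0` incurs no entropic cost, so it is
`r(s_0,a_0) + E ∑_{t ≥ 1} γ^t (r(s_t,a_t) - β⁻¹ log (π(a_t|s_t) / π₀(a_t|s_t)))`. -/
def softReturn (π : Policy S A) (x : S.Pt × A.Pt) : ℝ :=
  M.reward x + ∑' t : ℕ, M.disc ^ (t + 1) * ∫ y, M.regReward π y ∂M.saLaw π (t + 1) x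

/-- The optimal soft action-value function `Q*(s,a)`: the supremum of the regularized returns
over all policies. -/
def optimalQ (x : S.Pt × A.Pt) : ℝ :=
  sSup {v : ℝ | ∃ π : Policy S A, M.FiniteReturn π x ∧ v = M.softReturn π x}

/-! ### Lipschitz MDPs -/

/-- `(L_r, L_p)`-Lipschitz rewards and dynamics. The dynamics are Lipschitz for the Kantorovich
(1-Wasserstein) distance `sup_f |∫ f dp(·|x) - ∫ f dp(·|y)|`, `f` ranging over the `1`-Lipschitz
functions on the state space. -/
structure IsLipschitz (q : ℝ≥0∞) [Fact (1 ≤ q)] (Lr Lp : ℝ) : Prop where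
  reward_nonneg : 0 ≤ Lr
  trans_nonneg : 0 ≤ Lp
  reward_le : ∀ x y, |M.reward x - M.reward y| ≤ Lr * saDist q x y
  trans_le : ∀ x y, ∀ f : S.Pt → ℝ, LipschitzWith 1 f →
    |∫ s, f s ∂M.trans x - ∫ s, f s ∂M.trans y| ≤ Lp * saDist q x y

/-- `log π₀(a|s)` is `L_κ`-Lipschitz in the state `s`. -/
structure IsLipschitzPrior (Lk : ℝ) : Prop where
  nonneg : 0 ≤ Lk
  le : ∀ s s' a,
    |Real.log (M.prior.density s a) - Real.log (M.prior.density s' a)| ≤ Lk * dist s s'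

/-- The constant `L_Δ = L_r + L_Q + γ L_p (L_Q + β⁻¹ L_κ)`. -/
def lipDelta (Lr Lp Lk LQ : ℝ) : ℝ :=
  Lr + LQ + M.disc * Lp * (LQ + M.beta⁻¹ * Lk)

/-! ### Sampling -/

end MDP

/-- The kernel `a ↦ κ(a)^{⊗ k}` of `k` independent samples from `κ(a)`. -/
def iid {α β : Type*} [MeasurableSpace α] [MeasurableSpace β] (k : ℕ) (κ : Kernel α β)
    [IsMarkovKernel κ] : Kernel α (Fin k → β) where
  toFun a := Measure.pi fun _ => κ a
  measurable' := by
    refine Measurable.measure_of_isPiSystem_of_isProbabilityMeasure generateFrom_pi.symm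
      isPiSystem_pi ?_
    rintro _ ⟨s, hs, rfl⟩
    simp only [Measure.pi_pi]
    exact Finset.measurable_prod _ fun i _ => κ.measurable_coe (hs i (Set.mem_univ i))

instance {α β : Type*} [MeasurableSpace α] [MeasurableSpace β] (k : ℕ) (κ : Kernel α β)
    [IsMarkovKernel κ] : IsMarkovKernel (iid k κ) :=
  ⟨fun a => inferInstanceAs (IsProbabilityMeasure (Measure.pi fun _ => κ a))⟩

/-- `nS` next states, each with `nA` actions: the data for one estimate at one `(s,a)`. -/
abbrev NextSamples (S : Domain m) (A : Domain n) (nS nA : ℕ) : Type :=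
  Fin nS → S.Pt × (Fin nA → A.Pt)

/-- A batch of `N` state-action pairs, each with its own next-state and action samples. -/
abbrev BatchSamples (S : Domain m) (A : Domain n) (N nS nA : ℕ) : Type :=
  Fin N → (S.Pt × A.Pt) × NextSamples S A nS nA

namespace MDP

variable (M : MDP S A)

/-- At `(s,a)`: `nS` independent next states `s'_i ∼ p(·|s,a)`, and for each of them `nA`
independent actions from the prior `π₀(·|s'_i)`. -/
def nextLaw (nS nA : ℕ) : Kernel (S.Pt × A.Pt) (NextSamples S A nS nA) :=
  iid nS (M.trans ⊗ₖ Kernel.prodMkLeft (S.Pt × A.Pt) (iid nA M.prior.kernel))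

/-- `N` independent batch elements: `s ∼ Unif(S)`, `a ∼ Unif(A)`, and samples following `(s,a)`. -/
def batchLaw (N nS nA : ℕ) : Measure (BatchSamples S A N nS nA) :=
  Measure.pi fun _ => (S.unif.prod A.unif) ⊗ₘ M.nextLaw nS nA

/-- All samples: those at the state-action pair `x` of interest, and independently the batch. -/
def sampleLaw (N nS nA : ℕ) (x : S.Pt × A.Pt) :
    Measure (NextSamples S A nS nA × BatchSamples S A N nS nA) :=
  (M.nextLaw nS nA x).prod (M.batchLaw N nS nA)

/-! ### Estimates -/

/-- `V̂ = β⁻¹ log ((1/nA) ∑_i exp (β Q(s,a_i)))`, the estimate from actions `a_i` of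
`V(s) = β⁻¹ log E_{a ∼ π₀(·|s)} exp (β Q(s,a))`. -/
def vHat (Q : S.Pt × A.Pt → ℝ) {nA : ℕ} (s : S.Pt) (a : Fin nA → A.Pt) : ℝ :=
  M.beta⁻¹ * Real.log ((nA : ℝ)⁻¹ * ∑ i, Real.exp (M.beta * Q (s, a i)))

/-- The empirical mean `(1/nS) ∑_i V̂(s'_i)`. -/
def meanVHat (Q : S.Pt × A.Pt → ℝ) {nS nA : ℕ} (ω : NextSamples S A nS nA) : ℝ :=
  (nS : ℝ)⁻¹ * ∑ i, M.vHat Q (ω i).1 (ω i).2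

/-- `Δ̂(s,a) = r(s,a) + γ (1/nS) ∑_i V̂(s'_i) - Q(s,a)`. -/
def deltaHat (Q : S.Pt × A.Pt → ℝ) {nS nA : ℕ} (x : S.Pt × A.Pt)
    (ω : NextSamples S A nS nA) : ℝ :=
  M.reward x + M.disc * M.meanVHat Q ω - Q x

/-- The sample-based upper bound on `Q*(x)`, with slack `e`. -/
def upperBound (Q : S.Pt × A.Pt → ℝ) {N nS nA : ℕ} (e : ℝ) (x : S.Pt × A.Pt)
    (ω : NextSamples S A nS nA × BatchSamples S A N nS nA) : ℝ :=
  M.reward x + M.disc * (M.meanVHat Q ω.1 +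
    ((⨆ j, M.deltaHat Q (ω.2 j).1 (ω.2 j).2) + e) / (1 - M.disc))

/-- The sample-based lower bound on `Q*(x)`, with slack `e`. -/
def lowerBound (Q : S.Pt × A.Pt → ℝ) {N nS nA : ℕ} (e : ℝ) (x : S.Pt × A.Pt)
    (ω : NextSamples S A nS nA × BatchSamples S A N nS nA) : ℝ :=
  M.reward x + M.disc * (M.meanVHat Q ω.1 +
    ((⨅ j, M.deltaHat Q (ω.2 j).1 (ω.2 j).2) - e) / (1 - M.disc))

end MDP

end SoftRL

end

noncomputable section

namespace SoftRL

variable {m n : ℕ} {S : Domain m} {A : Domain n}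

/-! Write `V(s) = β⁻¹ log E_{π₀} exp(βQ)` and `Δ = r + γ E V(s') - Q`. For any policy the
regularized reward splits (`regReward_eq`) into `Q - β⁻¹ log(π/π₀) - V` plus `Δ + V - γ E V(s')`.
The first bracket has nonpositive mean by the Gibbs variational inequality and vanishes identically
for the Gibbs policy of `Q`; the discounted sum of the second telescopes, apart from `Δ`. Hence
`Q*(x)` lies between `r + γ(E V(s') + d/(1-γ))` for `d = inf Δ` and for `d = sup Δ`, so it has this
form for a single level `c` in `[inf Δ, sup Δ]` (`exists_optimalQ_eq`).

The level `c` serves both bounds: a single batch pair with `Δ` within `ε₁` of `c` and an accurate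
estimate already puts `min Δ̂` below and `max Δ̂` above `c`, up to the allowed slack
(`bounds_of_good_sample`). No accuracy is needed at the other pairs, and no union bound over the
batch.

Such pairs are not rare. `Δ` is `L_Δ`-Lipschitz on a connected domain, so it comes arbitrarily close
to `c` at some point `y`; shrinking the convex domain `S × A` towards `y` by a ratio `t` stays
inside it, keeps `Δ` near `c` and has probability `t^d` (`pow_le_measureReal_level`).

The mean of `V̂` is controlled in two steps. Hoeffding's inequality bounds its distance to its
expectation by `ε₂`. The expectation differs from `E V(s')` only by the bias of a logarithm of a
sample mean, which is at most `ε₃` by a variance estimate (`integral_log_mean_mem`) and has no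
failure probability. -/

lemma integrable_of_measurable_of_bounds {α : Type*} [MeasurableSpace α] {μ : Measure α}
    [IsFiniteMeasure μ] {f : α → ℝ} (hf : Measurable f) {lo hi : ℝ} (hlo : ∀ a, lo ≤ f a)
    (hhi : ∀ a, f a ≤ hi) : Integrable f μ :=
  Integrable.of_mem_Icc lo hi hf.aemeasurable (.of_forall fun a => ⟨hlo a, hhi a⟩)

lemma const_le_integral {α : Type*} [MeasurableSpace α] {μ : Measure α}
    [IsProbabilityMeasure μ] {f : α → ℝ} (hf : Integrable f μ) {lo : ℝ} (hlo : ∀ a, lo ≤ f a) :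
    lo ≤ ∫ a, f a ∂μ := by
  have h := integral_mono (integrable_const (μ := μ) lo) hf hlo
  simpa using h

lemma integral_le_of_forall_le {α : Type*} [MeasurableSpace α] {μ : Measure α}
    [IsProbabilityMeasure μ] {f : α → ℝ} (hf : Integrable f μ) {hi : ℝ} (hhi : ∀ a, f a ≤ hi) :
    ∫ a, f a ∂μ ≤ hi := by
  have h := integral_mono hf (integrable_const (μ := μ) hi) hhi
  simpa using h

/-! ### The product distance -/

section saDist

variable (q : ℝ≥0∞) [Fact (1 ≤ q)]

lemma saDist_fst (s s' : S.Pt) (a : A.Pt) : saDist q (s, a) (s', a) = dist s s' := by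
  rw [saDist, dist_eq_norm, ← WithLp.toLp_sub, Prod.mk_sub_mk, sub_self, WithLp.norm_toLp_fst,
    ← dist_eq_norm]
  rfl

lemma continuous_saDist_left (x : S.Pt × A.Pt) : Continuous fun y => saDist q y x := by
  unfold saDist
  have h : Continuous fun y : S.Pt × A.Pt =>
      WithLp.toLp q ((y.1 : EuclideanSpace ℝ (Fin m)), (y.2 : EuclideanSpace ℝ (Fin n))) :=
    (WithLp.prod_continuous_toLp q _ _).comp (by fun_prop)
  exact h.dist continuous_const

/-- Lipschitz bounds for the product distance are the only regularity assumed of `Q` and of the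
reward; their measurability comes from here. -/
lemma continuous_of_saDist_le {f : S.Pt × A.Pt → ℝ} {L : ℝ}
    (hf : ∀ x y, |f x - f y| ≤ L * saDist q x y) : Continuous f := by
  rw [continuous_iff_continuousAt]
  intro x
  rw [ContinuousAt, tendsto_iff_dist_tendsto_zero]
  have h : Filter.Tendsto (fun y => L * saDist q y x) (nhds x) (nhds 0) := by
    have h' := ((continuous_saDist_left q x).tendsto x).const_mul L
    have h0 : saDist q x x = 0 := dist_self _
    simpa [h0] using h'
  exact squeeze_zero (fun _ => dist_nonneg) (fun y => hf y x) h

lemma isBounded_range_toLp : Bornology.IsBounded (Set.range fun x : S.Pt × A.Pt =>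
    WithLp.toLp q ((x.1 : EuclideanSpace ℝ (Fin m)), (x.2 : EuclideanSpace ℝ (Fin n)))) := by
  have hb : Bornology.IsBounded (S.carrier ×ˢ A.carrier) := S.isBounded.prod A.isBounded
  have h := (WithLp.prod_lipschitzWith_toLp q (EuclideanSpace ℝ (Fin m))
    (EuclideanSpace ℝ (Fin n))).isBounded_image hb
  refine h.subset ?_
  rintro _ ⟨x, rfl⟩
  exact ⟨_, ⟨x.1.2, x.2.2⟩, rfl⟩

lemma saDist_le_saDiam (x y : S.Pt × A.Pt) : saDist q x y ≤ saDiam q S A :=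
  Metric.dist_le_diam_of_mem (isBounded_range_toLp q) ⟨x, rfl⟩ ⟨y, rfl⟩

end saDist

/-! ### Policies -/

lemma Policy.measurable_ofReal_density (π : Policy S A) :
    Measurable (Function.uncurry fun s a => ENNReal.ofReal (π.density s a)) :=
  π.measurable.ennreal_ofReal

lemma Policy.kernel_apply (π : Policy S A) (s : S.Pt) :
    π.kernel s = A.lebesgue.withDensity fun a => ENNReal.ofReal (π.density s a) := by
  rw [Policy.kernel, Kernel.withDensity_apply _ π.measurable_ofReal_density, Kernel.const_apply]

lemma Policy.measurable_density (π : Policy S A) (s : S.Pt) : Measurable (π.density s) :=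
  π.measurable.comp measurable_prodMk_left

lemma Policy.integral_kernel (π : Policy S A) (s : S.Pt) (f : A.Pt → ℝ) :
    ∫ a, f a ∂π.kernel s = ∫ a, π.density s a * f a ∂A.lebesgue := by
  rw [π.kernel_apply, integral_withDensity_eq_integral_toReal_smul
    (π.measurable_density s).ennreal_ofReal (.of_forall fun _ => ENNReal.ofReal_lt_top)]
  simp [ENNReal.toReal_ofReal (π.nonneg s _)]

lemma Policy.lintegral_kernel (π : Policy S A) (s : S.Pt) {f : A.Pt → ℝ≥0∞} (hf : Measurable f) :
    ∫⁻ a, f a ∂π.kernel s = ∫⁻ a, ENNReal.ofReal (π.density s a) * f a ∂A.lebesgue := by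
  rw [π.kernel_apply, lintegral_withDensity_eq_lintegral_mul _
    (π.measurable_density s).ennreal_ofReal hf]
  rfl

lemma Policy.integrable_kernel_iff (π : Policy S A) (s : S.Pt) (f : A.Pt → ℝ) :
    Integrable f (π.kernel s) ↔ Integrable (fun a => π.density s a * f a) A.lebesgue := by
  rw [π.kernel_apply, integrable_withDensity_iff_integrable_smul'
    (π.measurable_density s).ennreal_ofReal (.of_forall fun _ => ENNReal.ofReal_lt_top)]
  simp [ENNReal.toReal_ofReal (π.nonneg s _)]

lemma Policy.ae_density_ne_zero (π : Policy S A) (s : S.Pt) :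
    ∀ᵐ a ∂π.kernel s, π.density s a ≠ 0 := by
  rw [π.kernel_apply, ae_withDensity_iff (π.measurable_density s).ennreal_ofReal]
  refine .of_forall fun a h h0 => h ?_
  simp [h0]

namespace MDP

variable (M : MDP S A)

/-! ### The soft state value of an action-value function -/

/-- The soft state value `V(s) = β⁻¹ log E_{a ∼ π₀(·|s)} exp (β Q(s,a))`. -/
def softValue (Q : S.Pt × A.Pt → ℝ) (s : S.Pt) : ℝ :=
  M.beta⁻¹ * Real.log (∫ a, Real.exp (M.beta * Q (s, a)) ∂M.prior.kernel s)

/-- The expected soft value `E_{s' ∼ p(·|x)} V(s')` of the next state. -/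
def nextValue (Q : S.Pt × A.Pt → ℝ) (x : S.Pt × A.Pt) : ℝ :=
  ∫ s, M.softValue Q s ∂M.trans x

/-- The gap `Δ(x) = r(x) + γ E_{s' ∼ p(·|x)} V(s') - Q(x)` in the soft Bellman equation. -/
def bellmanGap (Q : S.Pt × A.Pt → ℝ) (x : S.Pt × A.Pt) : ℝ :=
  M.reward x + M.disc * M.nextValue Q x - Q x

variable {M} {Q : S.Pt × A.Pt → ℝ} {lo hi : ℝ}

lemma integrable_exp_mul (hQ : Measurable Q) (hhi : ∀ x, Q x ≤ hi)
    (s : S.Pt) (μ : Measure A.Pt) [IsFiniteMeasure μ] :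
    Integrable (fun a => Real.exp (M.beta * Q (s, a))) μ := by
  have := M.beta_pos
  refine integrable_of_measurable_of_bounds (lo := 0) (hi := Real.exp (M.beta * hi))
    (by fun_prop) (fun a => (Real.exp_pos _).le) fun a => ?_
  gcongr
  exact hhi _

lemma exp_le_integral_exp (hQ : Measurable Q) (hlo : ∀ x, lo ≤ Q x) (hhi : ∀ x, Q x ≤ hi)
    (s : S.Pt) :
    Real.exp (M.beta * lo) ≤ ∫ a, Real.exp (M.beta * Q (s, a)) ∂M.prior.kernel s := by
  have := M.beta_pos
  refine const_le_integral (integrable_exp_mul hQ hhi s _) fun a => ?_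
  gcongr
  exact hlo _

lemma integral_exp_le_exp (hQ : Measurable Q) (hhi : ∀ x, Q x ≤ hi)
    (s : S.Pt) :
    ∫ a, Real.exp (M.beta * Q (s, a)) ∂M.prior.kernel s ≤ Real.exp (M.beta * hi) := by
  have := M.beta_pos
  refine integral_le_of_forall_le (integrable_exp_mul hQ hhi s _) fun a => ?_
  gcongr
  exact hhi _

lemma exp_softValue (hQ : Measurable Q) (hlo : ∀ x, lo ≤ Q x) (hhi : ∀ x, Q x ≤ hi) (s : S.Pt) :
    Real.exp (M.beta * M.softValue Q s)
      = ∫ a, Real.exp (M.beta * Q (s, a)) ∂M.prior.kernel s := by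
  rw [softValue, mul_inv_cancel_left₀ M.beta_pos.ne', Real.exp_log]
  exact (Real.exp_pos _).trans_le (exp_le_integral_exp hQ hlo hhi s)

lemma le_softValue (hQ : Measurable Q) (hlo : ∀ x, lo ≤ Q x) (hhi : ∀ x, Q x ≤ hi) (s : S.Pt) :
    lo ≤ M.softValue Q s := by
  have h := exp_le_integral_exp (M := M) hQ hlo hhi s
  rw [← exp_softValue hQ hlo hhi, Real.exp_le_exp] at h
  exact le_of_mul_le_mul_left h M.beta_pos

lemma softValue_le (hQ : Measurable Q) (hlo : ∀ x, lo ≤ Q x) (hhi : ∀ x, Q x ≤ hi) (s : S.Pt) :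
    M.softValue Q s ≤ hi := by
  have h := integral_exp_le_exp (M := M) hQ hhi s
  rw [← exp_softValue hQ hlo hhi, Real.exp_le_exp] at h
  exact le_of_mul_le_mul_left h M.beta_pos

lemma measurable_softValue (hQ : Measurable Q) : Measurable (M.softValue Q) := by
  have h : StronglyMeasurable fun s => ∫ a, Real.exp (M.beta * Q (s, a)) ∂M.prior.kernel s :=
    StronglyMeasurable.integral_kernel_prod_right' (f := fun x => Real.exp (M.beta * Q x))
      (by have : Measurable fun x => Real.exp (M.beta * Q x) := by fun_prop
          exact this.stronglyMeasurable)
  exact (Real.measurable_log.comp h.measurable).const_mul _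

lemma integrable_softValue (hQ : Measurable Q) (hlo : ∀ x, lo ≤ Q x) (hhi : ∀ x, Q x ≤ hi)
    (μ : Measure S.Pt) [IsFiniteMeasure μ] : Integrable (M.softValue Q) μ :=
  integrable_of_measurable_of_bounds (measurable_softValue hQ) (le_softValue hQ hlo hhi)
    (softValue_le hQ hlo hhi)

lemma measurable_nextValue (hQ : Measurable Q) : Measurable (M.nextValue Q) :=
  (StronglyMeasurable.integral_kernel (measurable_softValue hQ).stronglyMeasurable).measurable

lemma le_nextValue (hQ : Measurable Q) (hlo : ∀ x, lo ≤ Q x) (hhi : ∀ x, Q x ≤ hi)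
    (x : S.Pt × A.Pt) : lo ≤ M.nextValue Q x :=
  const_le_integral (integrable_softValue hQ hlo hhi _) (le_softValue hQ hlo hhi)

lemma nextValue_le (hQ : Measurable Q) (hlo : ∀ x, lo ≤ Q x) (hhi : ∀ x, Q x ≤ hi)
    (x : S.Pt × A.Pt) : M.nextValue Q x ≤ hi :=
  integral_le_of_forall_le (integrable_softValue hQ hlo hhi _) (softValue_le hQ hlo hhi)

lemma measurable_bellmanGap (hr : Measurable M.reward) (hQ : Measurable Q) :
    Measurable (M.bellmanGap Q) :=
  (hr.add ((measurable_nextValue hQ).const_mul _)).sub hQ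

/-! ### Lipschitz bounds -/

/-- Against Lebesgue measure, which does not depend on the state, the integrand `π₀(a|s)
exp(βQ(s,a))` changes at most by the factor `exp(βc)` from `s'` to `s`; `β⁻¹ log` turns this factor
into `c`. -/
lemma softValue_sub_le {q : ℝ≥0∞} [Fact (1 ≤ q)] {LQ Lk : ℝ} (hprior : M.IsLipschitzPrior Lk)
    (hQ : ∀ x y, |Q x - Q y| ≤ LQ * saDist q x y) (hlo : ∀ x, lo ≤ Q x) (hhi : ∀ x, Q x ≤ hi)
    (s s' : S.Pt) :
    M.softValue Q s - M.softValue Q s' ≤ (LQ + M.beta⁻¹ * Lk) * dist s s' := by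
  have hb := M.beta_pos
  have hQm : Measurable Q := (continuous_of_saDist_le q hQ).measurable
  set c : ℝ := (LQ + M.beta⁻¹ * Lk) * dist s s' with hc
  have hint (s : S.Pt) := (M.prior.integrable_kernel_iff s _).1
    (integrable_exp_mul (M := M) hQm hhi s (M.prior.kernel s))
  have key : ∫ a, Real.exp (M.beta * Q (s, a)) ∂M.prior.kernel s
      ≤ Real.exp (M.beta * c) * ∫ a, Real.exp (M.beta * Q (s', a)) ∂M.prior.kernel s' := by
    rw [Policy.integral_kernel, Policy.integral_kernel, ← integral_const_mul]
    refine integral_mono (hint s) ((hint s').const_mul _) fun a => ?_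
    have h1 : Q (s, a) ≤ Q (s', a) + LQ * dist s s' := by
      have := (le_abs_self _).trans (hQ (s, a) (s', a))
      rw [saDist_fst] at this
      linarith
    have h2 := (le_abs_self _).trans (hprior.le s s' a)
    dsimp only
    rw [← Real.exp_log (M.prior_pos s a), ← Real.exp_log (M.prior_pos s' a), ← Real.exp_add,
      ← Real.exp_add, ← Real.exp_add, Real.exp_le_exp]
    have h3 : M.beta * c = M.beta * (LQ * dist s s') + Lk * dist s s' := by
      rw [hc]; field_simp
    rw [h3]
    have h4 := mul_le_mul_of_nonneg_left h1 hb.le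
    linarith
  rw [← exp_softValue hQm hlo hhi, ← exp_softValue hQm hlo hhi, ← Real.exp_add, Real.exp_le_exp,
    ← mul_add] at key
  linarith [le_of_mul_le_mul_left key hb]

lemma abs_nextValue_sub_le {q : ℝ≥0∞} [Fact (1 ≤ q)] {Lr Lp LQ Lk : ℝ} (hM : M.IsLipschitz q Lr Lp)
    (hprior : M.IsLipschitzPrior Lk) (hLQ : 0 ≤ LQ)
    (hQ : ∀ x y, |Q x - Q y| ≤ LQ * saDist q x y) (hlo : ∀ x, lo ≤ Q x) (hhi : ∀ x, Q x ≤ hi)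
    (x y : S.Pt × A.Pt) :
    |M.nextValue Q x - M.nextValue Q y| ≤ Lp * (LQ + M.beta⁻¹ * Lk) * saDist q x y := by
  set K : ℝ := LQ + M.beta⁻¹ * Lk with hK
  have hK0 : 0 ≤ K := by
    have := M.beta_pos
    have := hprior.nonneg
    positivity
  have hV (s s' : S.Pt) : |M.softValue Q s - M.softValue Q s'| ≤ K * dist s s' := by
    refine abs_sub_le_iff.2 ⟨softValue_sub_le hprior hQ hlo hhi s s', ?_⟩
    rw [dist_comm]
    exact softValue_sub_le hprior hQ hlo hhi s' s
  -- The Kantorovich hypothesis concerns 1-Lipschitz functions, so `V` is divided by `K`; for `K =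
  -- 0` it is constant.
  rcases hK0.eq_or_lt with h0 | hpos
  · have hc (s : S.Pt) : M.softValue Q s = M.softValue Q x.1 := by
      have := hV s x.1
      rw [← h0, zero_mul] at this
      exact sub_eq_zero.1 (abs_eq_zero.1 (le_antisymm this (abs_nonneg _)))
    simp [nextValue, hc, ← h0]
  · have hf : LipschitzWith 1 fun s => K⁻¹ * M.softValue Q s := by
      refine LipschitzWith.of_dist_le_mul fun s s' => ?_
      rw [Real.dist_eq, ← mul_sub, abs_mul, abs_of_pos (inv_pos.2 hpos), NNReal.coe_one, one_mul,
        inv_mul_le_iff₀ hpos]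
      exact hV s s'
    have h := hM.trans_le x y _ hf
    rw [integral_const_mul, integral_const_mul, ← mul_sub, abs_mul,
      abs_of_pos (inv_pos.2 hpos), inv_mul_le_iff₀ hpos] at h
    calc _ ≤ _ := h
      _ = _ := by ring

lemma abs_bellmanGap_sub_le {q : ℝ≥0∞} [Fact (1 ≤ q)] {Lr Lp LQ Lk : ℝ}
    (hM : M.IsLipschitz q Lr Lp) (hprior : M.IsLipschitzPrior Lk) (hLQ : 0 ≤ LQ)
    (hQ : ∀ x y, |Q x - Q y| ≤ LQ * saDist q x y) (hlo : ∀ x, lo ≤ Q x) (hhi : ∀ x, Q x ≤ hi)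
    (x y : S.Pt × A.Pt) :
    |M.bellmanGap Q x - M.bellmanGap Q y| ≤ M.lipDelta Lr Lp Lk LQ * saDist q x y := by
  have h1 := abs_le.1 (hM.reward_le x y)
  have h2 := abs_le.1 (hQ x y)
  have h3 := abs_le.1 (abs_nextValue_sub_le hM hprior hLQ hQ hlo hhi x y)
  have h4 := mul_le_mul_of_nonneg_left h3.1 M.disc_nonneg
  have h5 := mul_le_mul_of_nonneg_left h3.2 M.disc_nonneg
  unfold bellmanGap lipDelta
  rw [abs_le]
  constructor <;> nlinarith

lemma lipDelta_nonneg {q : ℝ≥0∞} [Fact (1 ≤ q)] {Lr Lp LQ Lk : ℝ}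
    (hM : M.IsLipschitz q Lr Lp) (hprior : M.IsLipschitzPrior Lk) (hLQ : 0 ≤ LQ) :
    0 ≤ M.lipDelta Lr Lp Lk LQ := by
  have := hM.reward_nonneg
  have := hM.trans_nonneg
  have := hprior.nonneg
  have := M.beta_pos
  have := M.disc_nonneg
  unfold lipDelta
  positivity

variable (M)

/-! ### The law of the state-action process -/

instance (π : Policy S A) : IsMarkovKernel (M.step π) :=
  inferInstanceAs (IsMarkovKernel (M.trans ⊗ₖ Kernel.prodMkLeft (S.Pt × A.Pt) π.kernel))

instance (π : Policy S A) (t : ℕ) : IsMarkovKernel (M.saLaw π t) := by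
  induction t with
  | zero => exact inferInstanceAs (IsMarkovKernel (Kernel.id : Kernel (S.Pt × A.Pt) _))
  | succ t ih => exact inferInstanceAs (IsMarkovKernel (M.step π ∘ₖ M.saLaw π t))

/-- From time 1 on, the pair is a random state followed by an action drawn from `π`, which is the
setting of the Gibbs inequality. -/
lemma saLaw_succ_eq_compProd (π : Policy S A) (t : ℕ) (x : S.Pt × A.Pt) :
    M.saLaw π (t + 1) x = ((M.trans ∘ₖ M.saLaw π t) x) ⊗ₘ π.kernel := by
  rw [saLaw, step, Kernel.compProd_prodMkLeft_eq_comp, Kernel.comp_assoc,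
    Measure.compProd_eq_comp_prod, Kernel.comp_apply (_ ×ₖ _)]

lemma integral_saLaw_succ_fst (π : Policy S A) (t : ℕ) (x : S.Pt × A.Pt) {f : S.Pt → ℝ}
    (hf : Measurable f) {lo hi : ℝ} (hlo : ∀ s, lo ≤ f s) (hhi : ∀ s, f s ≤ hi) :
    ∫ y, f y.1 ∂M.saLaw π (t + 1) x = ∫ y, ∫ s, f s ∂M.trans y ∂M.saLaw π t x := by
  rw [saLaw_succ_eq_compProd, Measure.integral_compProd
    (integrable_of_measurable_of_bounds (by fun_prop) (fun y => hlo y.1) (fun y => hhi y.1))]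
  simp only [integral_const, probReal_univ, one_smul]
  rw [Kernel.integral_comp (integrable_of_measurable_of_bounds hf hlo hhi)]

variable {M}

/-! ### The Gibbs policy -/

/-- The Gibbs policy `π(a|s) = π₀(a|s) exp (β (Q(s,a) - V(s)))`. -/
def gibbsPolicy (M : MDP S A) (hQ : Measurable Q) (hlo : ∀ x, lo ≤ Q x) (hhi : ∀ x, Q x ≤ hi) :
    Policy S A where
  density s a := M.prior.density s a * Real.exp (M.beta * (Q (s, a) - M.softValue Q s))
  measurable := by
    have h1 := M.prior.measurable
    have h2 := measurable_softValue (M := M) hQ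
    change Measurable fun x : S.Pt × A.Pt => Function.uncurry M.prior.density x *
      Real.exp (M.beta * (Q x - M.softValue Q x.1))
    fun_prop
  nonneg s a := mul_nonneg (M.prior.nonneg s a) (Real.exp_pos _).le
  integral_eq_one s := by
    simp_rw [mul_sub, Real.exp_sub]
    rw [← Policy.integral_kernel, integral_div, exp_softValue hQ hlo hhi, div_self]
    exact ((Real.exp_pos _).trans_le (exp_le_integral_exp hQ hlo hhi s)).ne'

lemma log_gibbsPolicy_div_prior (hQ : Measurable Q) (hlo : ∀ x, lo ≤ Q x) (hhi : ∀ x, Q x ≤ hi)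
    (s : S.Pt) (a : A.Pt) :
    M.beta⁻¹ * Real.log ((gibbsPolicy M hQ hlo hhi).density s a / M.prior.density s a)
      = Q (s, a) - M.softValue Q s := by
  simp only [gibbsPolicy]
  rw [mul_div_cancel_left₀ _ (M.prior_pos s a).ne', Real.log_exp,
    inv_mul_cancel_left₀ M.beta_pos.ne']

/-- The Gibbs variational inequality for `V`, averaged over a state distribution. -/
lemma integral_sub_log_sub_softValue_nonpos (hQ : Measurable Q) (hlo : ∀ x, lo ≤ Q x)
    (hhi : ∀ x, Q x ≤ hi) (π : Policy S A) (ν : Measure S.Pt) [IsProbabilityMeasure ν]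
    (hint : Integrable (fun x => Q x
      - M.beta⁻¹ * Real.log (π.density x.1 x.2 / M.prior.density x.1 x.2)
      - M.softValue Q x.1) (ν ⊗ₘ π.kernel)) :
    ∫ x, (Q x - M.beta⁻¹ * Real.log (π.density x.1 x.2 / M.prior.density x.1 x.2)
      - M.softValue Q x.1) ∂(ν ⊗ₘ π.kernel) ≤ 0 := by
  have hb := M.beta_pos
  set G := gibbsPolicy M hQ hlo hhi with hG
  have hmG : Measurable fun x : S.Pt × A.Pt => G.density x.1 x.2 := G.measurable
  have hmπ : Measurable fun x : S.Pt × A.Pt => π.density x.1 x.2 := π.measurable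
  set g : S.Pt × A.Pt → ℝ := fun x => G.density x.1 x.2 / π.density x.1 x.2 with hg
  have hgm : Measurable g := hmG.div hmπ
  have hg0 (x : S.Pt × A.Pt) : 0 ≤ g x := div_nonneg (G.nonneg _ _) (π.nonneg _ _)
  -- Only `≤ 1`: the Gibbs mass on the zeros of the density of `π` is lost, since there `g = 0` by
  -- the convention for division by zero.
  have hl : ∫⁻ x, ENNReal.ofReal (g x) ∂(ν ⊗ₘ π.kernel) ≤ 1 := by
    rw [Measure.lintegral_compProd hgm.ennreal_ofReal]
    have h1 (s : S.Pt) : ∫⁻ a, ENNReal.ofReal (g (s, a)) ∂π.kernel s ≤ 1 := by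
      rw [π.lintegral_kernel s (by fun_prop)]
      calc _ ≤ ∫⁻ a, ENNReal.ofReal (G.density s a) * 1 ∂A.lebesgue := by
            refine lintegral_mono fun a => ?_
            rw [mul_one, ← ENNReal.ofReal_mul (π.nonneg s a)]
            refine ENNReal.ofReal_le_ofReal ?_
            rcases (π.nonneg s a).eq_or_lt with h | h
            · rw [← h, zero_mul]; exact G.nonneg s a
            · exact (mul_div_cancel₀ (G.density s a) h.ne').le
        _ = 1 := by
            rw [← G.lintegral_kernel s measurable_const]
            simp
    calc _ ≤ ∫⁻ _, 1 ∂ν := lintegral_mono h1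
      _ = 1 := by simp
  have hgint : Integrable g (ν ⊗ₘ π.kernel) := by
    refine ⟨hgm.aestronglyMeasurable, ?_⟩
    rw [hasFiniteIntegral_iff_ofReal (.of_forall hg0)]
    exact hl.trans_lt ENNReal.one_lt_top
  have hg1 : ∫ x, g x ∂(ν ⊗ₘ π.kernel) ≤ 1 := by
    rw [integral_eq_lintegral_of_nonneg_ae (.of_forall hg0) hgm.aestronglyMeasurable]
    exact ENNReal.toReal_le_of_le_ofReal zero_le_one (by simpa using hl)
  -- The logarithms are genuine only where the density of `π` is nonzero, which is almost everywhere
  -- for `π` itself.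
  have hae : ∀ᵐ x ∂(ν ⊗ₘ π.kernel), π.density x.1 x.2 ≠ 0 := by
    refine (Measure.ae_compProd_iff (hmπ (measurableSet_singleton (0 : ℝ)).compl)).2 ?_
    exact .of_forall fun s => π.ae_density_ne_zero s
  have hle : ∀ᵐ x ∂(ν ⊗ₘ π.kernel), Q x
      - M.beta⁻¹ * Real.log (π.density x.1 x.2 / M.prior.density x.1 x.2)
      - M.softValue Q x.1 ≤ M.beta⁻¹ * (g x - 1) := by
    filter_upwards [hae] with x hx
    have h0 : 0 < M.prior.density x.1 x.2 := M.prior_pos _ _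
    have hGpos : 0 < G.density x.1 x.2 := mul_pos h0 (Real.exp_pos _)
    have hπ : 0 < π.density x.1 x.2 := lt_of_le_of_ne (π.nonneg _ _) hx.symm
    have h1 := log_gibbsPolicy_div_prior (M := M) hQ hlo hhi x.1 x.2
    rw [← hG] at h1
    -- The left side of the claim is `β⁻¹ log g`, as `Q - V = β⁻¹ log(G/π₀)`; then `log g ≤ g - 1`.
    have h2 := Real.log_le_sub_one_of_pos (div_pos hGpos hπ)
    rw [Real.log_div hGpos.ne' hπ.ne'] at h2
    rw [Real.log_div hGpos.ne' h0.ne'] at h1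
    rw [Real.log_div hπ.ne' h0.ne']
    have h3 := mul_le_mul_of_nonneg_left h2 (inv_pos.2 hb).le
    simp only [hg]
    change M.beta⁻¹ * _ = Q x - _ at h1
    linarith
  calc _ ≤ ∫ x, M.beta⁻¹ * (g x - 1) ∂(ν ⊗ₘ π.kernel) :=
        integral_mono_ae hint ((hgint.sub (integrable_const 1)).const_mul _) hle
    _ = M.beta⁻¹ * (∫ x, g x ∂(ν ⊗ₘ π.kernel) - 1) := by
        rw [integral_const_mul, integral_sub hgint (integrable_const 1)]
        simp
    _ ≤ 0 := mul_nonpos_of_nonneg_of_nonpos (inv_pos.2 hb).le (by linarith)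

/-! ### Bounds on the optimal value by telescoping the Bellman gap -/

lemma hasSum_telescope {f : ℕ → ℝ} (hf : Summable f) : HasSum (fun t => f t - f (t + 1)) (f 0) := by
  have h1 := hf.hasSum
  have h2 := ((summable_nat_add_iff 1).2 hf).hasSum
  have h3 := h1.sub h2
  rwa [hf.tsum_eq_zero_add, add_sub_cancel_right] at h3

/-- The terms `γ^(t+1) v t` telescope to `γ v 0`, while the constant `d` is summed geometrically
from exponent 1. -/
lemma hasSum_disc_telescope (M : MDP S A) (v : ℕ → ℝ) (hv : ∀ t, lo ≤ v t ∧ v t ≤ hi) (d : ℝ) :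
    HasSum (fun t : ℕ => M.disc ^ (t + 1) * (d + v t - M.disc * v (t + 1)))
      (M.disc * (v 0 + d / (1 - M.disc))) := by
  have hg := (summable_geometric_of_lt_one M.disc_nonneg M.disc_lt_one)
  have hs : Summable fun t : ℕ => M.disc ^ (t + 1) * v t := by
    refine Summable.of_norm_bounded
      (g := fun t => M.disc ^ t * (M.disc * max |lo| |hi|)) (hg.mul_right _) fun t => ?_
    rw [norm_mul, norm_pow, Real.norm_of_nonneg M.disc_nonneg, pow_succ, mul_assoc]
    have := M.disc_nonneg
    gcongr
    exact abs_le_max_abs_abs (hv t).1 (hv t).2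
  have h1 := hasSum_telescope hs
  have h2 := (hasSum_geometric_of_lt_one M.disc_nonneg M.disc_lt_one).mul_right (M.disc * d)
  have h3 : M.disc * (v 0 + d / (1 - M.disc))
      = (1 - M.disc)⁻¹ * (M.disc * d) + M.disc ^ (0 + 1) * v 0 := by ring
  rw [h3]
  have h4 : (fun t : ℕ => M.disc ^ (t + 1) * (d + v t - M.disc * v (t + 1))) = fun t : ℕ =>
      M.disc ^ t * (M.disc * d)
        + (M.disc ^ (t + 1) * v t - M.disc ^ (t + 1 + 1) * v (t + 1)) := by
    funext t; ring
  rw [h4]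
  exact h2.add h1

/-- The first bracket is the one governed by the Gibbs variational inequality; the second telescopes
along the process. -/
lemma regReward_eq (π : Policy S A) (y : S.Pt × A.Pt) :
    M.regReward π y = (Q y - M.beta⁻¹ * Real.log (π.density y.1 y.2 / M.prior.density y.1 y.2)
      - M.softValue Q y.1) + (M.bellmanGap Q y + M.softValue Q y.1
        - M.disc * M.nextValue Q y) := by
  simp only [regReward, bellmanGap]; ring

lemma integrable_softValue_fst (hQ : Measurable Q) (hlo : ∀ x, lo ≤ Q x) (hhi : ∀ x, Q x ≤ hi)
    (μ : Measure (S.Pt × A.Pt)) [IsFiniteMeasure μ] :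
    Integrable (fun y => M.softValue Q y.1) μ := by
  have hm := measurable_softValue (M := M) hQ
  exact integrable_of_measurable_of_bounds (by fun_prop) (fun y => le_softValue hQ hlo hhi y.1)
    fun y => softValue_le hQ hlo hhi y.1

lemma integrable_nextValue (hQ : Measurable Q) (hlo : ∀ x, lo ≤ Q x) (hhi : ∀ x, Q x ≤ hi)
    (μ : Measure (S.Pt × A.Pt)) [IsFiniteMeasure μ] : Integrable (M.nextValue Q) μ :=
  integrable_of_measurable_of_bounds (measurable_nextValue hQ) (le_nextValue hQ hlo hhi)
    (nextValue_le hQ hlo hhi)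

/-- The expected soft value at time `t + 1` of the process that starts at `x`. -/
def valueAt (M : MDP S A) (Q : S.Pt × A.Pt → ℝ) (π : Policy S A) (x : S.Pt × A.Pt) (t : ℕ) : ℝ :=
  ∫ y, M.softValue Q y.1 ∂M.saLaw π (t + 1) x

lemma valueAt_mem (hQ : Measurable Q) (hlo : ∀ x, lo ≤ Q x) (hhi : ∀ x, Q x ≤ hi)
    (π : Policy S A) (x : S.Pt × A.Pt) (t : ℕ) :
    lo ≤ M.valueAt Q π x t ∧ M.valueAt Q π x t ≤ hi := by
  have hint := integrable_softValue_fst (M := M) hQ hlo hhi (M.saLaw π (t + 1) x)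
  exact ⟨const_le_integral hint fun y => le_softValue hQ hlo hhi y.1,
    integral_le_of_forall_le hint fun y => softValue_le hQ hlo hhi y.1⟩

lemma valueAt_zero (hQ : Measurable Q) (hlo : ∀ x, lo ≤ Q x) (hhi : ∀ x, Q x ≤ hi)
    (π : Policy S A) (x : S.Pt × A.Pt) : M.valueAt Q π x 0 = M.nextValue Q x := by
  rw [valueAt, integral_saLaw_succ_fst M π 0 x (measurable_softValue hQ)
    (le_softValue hQ hlo hhi) (softValue_le hQ hlo hhi)]
  have hm := (measurable_nextValue (M := M) hQ).stronglyMeasurable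
  change ∫ y, M.nextValue Q y ∂(Kernel.id x) = _
  rw [Kernel.id_apply, integral_dirac' _ _ hm]

/-- Markov property: the value term subtracted at one time is the one added at the next, which is
what lets the sum telescope. -/
lemma valueAt_succ (hQ : Measurable Q) (hlo : ∀ x, lo ≤ Q x) (hhi : ∀ x, Q x ≤ hi)
    (π : Policy S A) (x : S.Pt × A.Pt) (t : ℕ) :
    M.valueAt Q π x (t + 1) = ∫ y, M.nextValue Q y ∂M.saLaw π (t + 1) x :=
  integral_saLaw_succ_fst M π (t + 1) x (measurable_softValue hQ)
    (le_softValue hQ hlo hhi) (softValue_le hQ hlo hhi)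

lemma integral_bellmanGap_add (hr : Measurable M.reward) (hQ : Measurable Q)
    (hlo : ∀ x, lo ≤ Q x) (hhi : ∀ x, Q x ≤ hi) {dlo dhi : ℝ}
    (hdlo : ∀ x, dlo ≤ M.bellmanGap Q x) (hdhi : ∀ x, M.bellmanGap Q x ≤ dhi)
    (π : Policy S A) (x : S.Pt × A.Pt) (t : ℕ) :
    Integrable (fun y => M.bellmanGap Q y + M.softValue Q y.1 - M.disc * M.nextValue Q y)
      (M.saLaw π (t + 1) x) ∧
    dlo + M.valueAt Q π x t - M.disc * M.valueAt Q π x (t + 1) ≤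
      ∫ y, (M.bellmanGap Q y + M.softValue Q y.1 - M.disc * M.nextValue Q y)
        ∂M.saLaw π (t + 1) x ∧
    ∫ y, (M.bellmanGap Q y + M.softValue Q y.1 - M.disc * M.nextValue Q y) ∂M.saLaw π (t + 1) x
      ≤ dhi + M.valueAt Q π x t - M.disc * M.valueAt Q π x (t + 1) := by
  set μ := M.saLaw π (t + 1) x with hμ
  have hg : Integrable (M.bellmanGap Q) μ :=
    integrable_of_measurable_of_bounds (measurable_bellmanGap hr hQ) hdlo hdhi
  have hv := integrable_softValue_fst (M := M) hQ hlo hhi μ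
  have hn := (integrable_nextValue (M := M) hQ hlo hhi μ).const_mul M.disc
  have hs : Integrable (fun y => M.bellmanGap Q y + M.softValue Q y.1) μ := hg.add hv
  rw [integral_sub hs hn, integral_add hg hv, integral_const_mul, hμ,
    ← valueAt_succ hQ hlo hhi, ← valueAt, ← hμ]
  have h1 := const_le_integral hg hdlo
  have h2 := integral_le_of_forall_le hg hdhi
  exact ⟨hs.sub hn, by linarith, by linarith⟩

lemma softReturn_le (hr : Measurable M.reward) (hQ : Measurable Q)
    (hlo : ∀ x, lo ≤ Q x) (hhi : ∀ x, Q x ≤ hi) {dlo dhi : ℝ}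
    (hdlo : ∀ x, dlo ≤ M.bellmanGap Q x) (hdhi : ∀ x, M.bellmanGap Q x ≤ dhi)
    (π : Policy S A) (x : S.Pt × A.Pt) (hπ : M.FiniteReturn π x) :
    M.softReturn π x ≤ M.reward x + M.disc * (M.nextValue Q x + dhi / (1 - M.disc)) := by
  have hsum := hasSum_disc_telescope M (M.valueAt Q π x) (valueAt_mem hQ hlo hhi π x) dhi
  rw [valueAt_zero hQ hlo hhi] at hsum
  have hs : Summable fun t : ℕ =>
      M.disc ^ (t + 1) * ∫ y, M.regReward π y ∂M.saLaw π (t + 1) x := by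
    refine Summable.of_norm_bounded hπ.2 fun t => ?_
    rw [norm_mul, norm_pow, Real.norm_of_nonneg M.disc_nonneg]
    have := M.disc_nonneg
    gcongr
    exact norm_integral_le_integral_norm _
  rw [softReturn, ← hsum.tsum_eq]
  refine add_le_add_right (hs.tsum_le_tsum (fun t => ?_) hsum.summable) _
  refine mul_le_mul_of_nonneg_left ?_ (pow_nonneg M.disc_nonneg _)
  obtain ⟨h1, -, h3⟩ := integral_bellmanGap_add hr hQ hlo hhi hdlo hdhi π x t
  have h4 : Integrable (fun y => Q y
      - M.beta⁻¹ * Real.log (π.density y.1 y.2 / M.prior.density y.1 y.2)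
      - M.softValue Q y.1) (M.saLaw π (t + 1) x) := by
    refine ((hπ.1 t).sub h1).congr (.of_forall fun y => ?_)
    simp only [Pi.sub_apply]
    rw [regReward_eq (Q := Q), add_sub_cancel_right]
  simp_rw [regReward_eq (Q := Q)]
  rw [integral_add h4 h1]
  rw [saLaw_succ_eq_compProd] at h4
  have h5 := integral_sub_log_sub_softValue_nonpos hQ hlo hhi π _ h4
  rw [← saLaw_succ_eq_compProd] at h5
  linarith

/-- For the Gibbs policy the entropic bracket is identically zero, so the regularized reward is
bounded and its discounted sum compares termwise with the telescoping sum. It also shows that the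
supremum defining `optimalQ` is over a nonempty set. -/
lemma finiteReturn_gibbsPolicy (hr : Measurable M.reward) (hQ : Measurable Q)
    (hlo : ∀ x, lo ≤ Q x) (hhi : ∀ x, Q x ≤ hi) {dlo dhi : ℝ}
    (hdlo : ∀ x, dlo ≤ M.bellmanGap Q x) (hdhi : ∀ x, M.bellmanGap Q x ≤ dhi)
    (x : S.Pt × A.Pt) :
    M.FiniteReturn (gibbsPolicy M hQ hlo hhi) x ∧
      M.reward x + M.disc * (M.nextValue Q x + dlo / (1 - M.disc))
        ≤ M.softReturn (gibbsPolicy M hQ hlo hhi) x := by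
  set π := gibbsPolicy M hQ hlo hhi with hπ
  have hγ := M.disc_nonneg
  have hreg (y : S.Pt × A.Pt) : M.regReward π y
      = M.bellmanGap Q y + M.softValue Q y.1 - M.disc * M.nextValue Q y := by
    rw [regReward_eq (Q := Q), hπ, log_gibbsPolicy_div_prior]
    simp
  set B : ℝ := max |dlo| |dhi| + max |lo| |hi| + M.disc * max |lo| |hi| with hB
  have hbound (y : S.Pt × A.Pt) : |M.regReward π y| ≤ B := by
    rw [hreg, hB]
    refine (abs_sub _ _).trans (add_le_add ((abs_add_le _ _).trans (add_le_add ?_ ?_)) ?_)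
    · exact abs_le_max_abs_abs (hdlo y) (hdhi y)
    · exact abs_le_max_abs_abs (le_softValue hQ hlo hhi y.1) (softValue_le hQ hlo hhi y.1)
    · rw [abs_mul, abs_of_nonneg hγ]
      gcongr
      exact abs_le_max_abs_abs (le_nextValue hQ hlo hhi y) (nextValue_le hQ hlo hhi y)
  have hfin : M.FiniteReturn π x := by
    have hi (t : ℕ) : Integrable (M.regReward π) (M.saLaw π (t + 1) x) :=
      (integral_bellmanGap_add hr hQ hlo hhi hdlo hdhi π x t).1.congr
        (.of_forall fun y => (hreg y).symm)
    refine ⟨hi, ?_⟩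
    refine Summable.of_nonneg_of_le (fun t => by positivity) (fun t => ?_)
      ((summable_geometric_of_lt_one M.disc_nonneg M.disc_lt_one).mul_right (M.disc * B))
    rw [pow_succ, mul_assoc]
    gcongr
    exact integral_le_of_forall_le (hi t).abs hbound
  refine ⟨hfin, ?_⟩
  have hsum := hasSum_disc_telescope M (M.valueAt Q π x) (valueAt_mem hQ hlo hhi π x) dlo
  rw [valueAt_zero hQ hlo hhi] at hsum
  have hs : Summable fun t : ℕ =>
      M.disc ^ (t + 1) * ∫ y, M.regReward π y ∂M.saLaw π (t + 1) x := by
    refine Summable.of_norm_bounded hfin.2 fun t => ?_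
    rw [norm_mul, norm_pow, Real.norm_of_nonneg M.disc_nonneg]
    gcongr
    exact norm_integral_le_integral_norm _
  rw [softReturn, ← hsum.tsum_eq]
  refine add_le_add_right (hsum.summable.tsum_le_tsum (fun t => ?_) hs) _
  refine mul_le_mul_of_nonneg_left ?_ (pow_nonneg M.disc_nonneg _)
  simp_rw [hreg]
  exact (integral_bellmanGap_add hr hQ hlo hhi hdlo hdhi π x t).2.1

/-- The optimal value lies between the values obtained from the bounds of the Bellman gap. -/
theorem optimalQ_mem_Icc (hr : Measurable M.reward) (hQ : Measurable Q)
    (hlo : ∀ x, lo ≤ Q x) (hhi : ∀ x, Q x ≤ hi) {dlo dhi : ℝ}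
    (hdlo : ∀ x, dlo ≤ M.bellmanGap Q x) (hdhi : ∀ x, M.bellmanGap Q x ≤ dhi)
    (x : S.Pt × A.Pt) :
    M.reward x + M.disc * (M.nextValue Q x + dlo / (1 - M.disc)) ≤ M.optimalQ x ∧
      M.optimalQ x ≤ M.reward x + M.disc * (M.nextValue Q x + dhi / (1 - M.disc)) := by
  obtain ⟨h1, h2⟩ := finiteReturn_gibbsPolicy hr hQ hlo hhi hdlo hdhi x
  have hub : ∀ v ∈ {v : ℝ | ∃ π : Policy S A, M.FiniteReturn π x ∧ v = M.softReturn π x},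
      v ≤ M.reward x + M.disc * (M.nextValue Q x + dhi / (1 - M.disc)) := by
    rintro _ ⟨π, hπ, rfl⟩
    exact softReturn_le hr hQ hlo hhi hdlo hdhi π x hπ
  exact ⟨h2.trans (le_csSup ⟨_, hub⟩ ⟨_, h1, rfl⟩), csSup_le ⟨_, _, h1, rfl⟩ hub⟩

/-- The optimal value is given by a level `c` between the infimum and the supremum of the
Bellman gap. -/
theorem exists_optimalQ_eq (hr : Measurable M.reward) (hQ : Measurable Q)
    (hlo : ∀ x, lo ≤ Q x) (hhi : ∀ x, Q x ≤ hi) (hb : BddBelow (Set.range (M.bellmanGap Q)))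
    (ha : BddAbove (Set.range (M.bellmanGap Q))) (x : S.Pt × A.Pt) :
    ∃ c : ℝ, (⨅ y, M.bellmanGap Q y) ≤ c ∧ c ≤ (⨆ y, M.bellmanGap Q y) ∧
      M.optimalQ x = M.reward x + M.disc * (M.nextValue Q x + c / (1 - M.disc)) := by
  obtain ⟨h1, h2⟩ := optimalQ_mem_Icc hr hQ hlo hhi (ciInf_le hb) (le_ciSup ha) x
  have hle : (⨅ y, M.bellmanGap Q y) ≤ ⨆ y, M.bellmanGap Q y :=
    (ciInf_le hb x).trans (le_ciSup ha x)
  have hγ : 0 < 1 - M.disc := sub_pos.2 M.disc_lt_one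
  -- The intermediate value theorem, instead of solving for `c`, also covers `γ = 0`, where the map
  -- is constant.
  have hcont : ContinuousOn (fun c : ℝ =>
      M.reward x + M.disc * (M.nextValue Q x + c / (1 - M.disc)))
      (Set.Icc (⨅ y, M.bellmanGap Q y) (⨆ y, M.bellmanGap Q y)) := by fun_prop
  obtain ⟨c, hc, hc'⟩ := intermediate_value_Icc hle hcont ⟨h1, h2⟩
  exact ⟨c, hc.1, hc.2, hc'.symm⟩

end MDP

/-! ### Sample means -/

section sampleMean

variable {α : Type*} [MeasurableSpace α] {μ : Measure α} [IsProbabilityMeasure μ]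

lemma integrable_eval_pi {k : ℕ} {f : α → ℝ} (hf : Integrable f μ) (i : Fin k) :
    Integrable (fun ω : Fin k → α => f (ω i)) (Measure.pi fun _ => μ) :=
  (measurePreserving_eval (fun _ : Fin k => μ) i).integrable_comp_of_integrable hf

lemma integral_eval_pi {k : ℕ} {f : α → ℝ} (hf : Integrable f μ) (i : Fin k) :
    ∫ ω : Fin k → α, f (ω i) ∂(Measure.pi fun _ => μ) = ∫ a, f a ∂μ := by
  have h := measurePreserving_eval (fun _ : Fin k => μ) i
  have h' := integral_map (μ := Measure.pi fun _ : Fin k => μ) (φ := Function.eval i) (f := f)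
    h.measurable.aemeasurable (by rw [h.map_eq]; exact hf.aestronglyMeasurable)
  rw [h.map_eq] at h'
  exact h'.symm

lemma integral_mean_pi {k : ℕ} (hk : 1 ≤ k) {f : α → ℝ} (hf : Integrable f μ) :
    ∫ ω : Fin k → α, (k : ℝ)⁻¹ * ∑ i, f (ω i) ∂(Measure.pi fun _ => μ) = ∫ a, f a ∂μ := by
  have hk' : (k : ℝ) ≠ 0 := by positivity
  rw [integral_const_mul, integral_finsetSum _ fun i _ => integrable_eval_pi hf i]
  simp_rw [integral_eval_pi hf]
  simp [hk']

lemma le_mean_of_le {k : ℕ} (hk : 1 ≤ k) {v : Fin k → ℝ} {a : ℝ} (h : ∀ i, a ≤ v i) :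
    a ≤ (k : ℝ)⁻¹ * ∑ i, v i := by
  have hk' : (0 : ℝ) < k := by positivity
  rw [le_inv_mul_iff₀ hk']
  have := Finset.card_nsmul_le_sum Finset.univ v a fun i _ => h i
  simpa using this

lemma mean_le_of_le {k : ℕ} (hk : 1 ≤ k) {v : Fin k → ℝ} {b : ℝ} (h : ∀ i, v i ≤ b) :
    (k : ℝ)⁻¹ * ∑ i, v i ≤ b := by
  have hk' : (0 : ℝ) < k := by positivity
  rw [inv_mul_le_iff₀ hk']
  have := Finset.sum_le_card_nsmul Finset.univ v b fun i _ => h i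
  simpa using this

/-- Independence divides the variance by `k`, and Popoviciu's inequality bounds the variance of a
variable in `[a, b]`. -/
lemma integral_sq_mean_sub_le {k : ℕ} (hk : 1 ≤ k) {g : α → ℝ} (hg : Measurable g) {a b : ℝ}
    (ha : ∀ x, a ≤ g x) (hb : ∀ x, g x ≤ b) :
    ∫ ω : Fin k → α, ((k : ℝ)⁻¹ * ∑ i, g (ω i) - ∫ x, g x ∂μ) ^ 2 ∂(Measure.pi fun _ => μ)
      ≤ (k : ℝ)⁻¹ * ((b - a) / 2) ^ 2 := by
  have hk' : (k : ℝ) ≠ 0 := by positivity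
  have hint : Integrable g μ := integrable_of_measurable_of_bounds hg ha hb
  have hmem : MemLp g 2 μ := by
    refine MemLp.of_bound hg.aestronglyMeasurable (max |a| |b|) (.of_forall fun x => ?_)
    exact abs_le_max_abs_abs (ha x) (hb x)
  have hZ : Measurable fun ω : Fin k → α => (k : ℝ)⁻¹ * ∑ i, g (ω i) := by fun_prop
  rw [← integral_mean_pi hk hint, ← variance_eq_integral hZ.aemeasurable, variance_const_mul]
  have h1 := variance_sum_pi (μ := fun _ : Fin k => μ) (X := fun _ => g) fun _ => hmem
  have h2 : (∑ i : Fin k, fun ω : Fin k → α => g (ω i)) = fun ω => ∑ i, g (ω i) := by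
    funext ω; simp
  rw [h2] at h1
  rw [h1]
  have h3 : Var[g; μ] ≤ ((b - a) / 2) ^ 2 :=
    variance_le_sq_of_bounded (.of_forall fun x => ⟨ha x, hb x⟩) hg.aemeasurable
  simp only [Finset.sum_const, Finset.card_univ, Fintype.card_fin, nsmul_eq_mul]
  calc (k : ℝ)⁻¹ ^ 2 * (k * Var[g; μ]) = (k : ℝ)⁻¹ * Var[g; μ] := by field_simp
    _ ≤ _ := by gcongr

/-- The bias of the logarithm of a sample mean of a function with values in `[a, b]`, `a > 0`. -/
lemma integral_log_mean_mem {k : ℕ} (hk : 1 ≤ k) {g : α → ℝ} (hg : Measurable g) {a b η : ℝ}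
    (ha0 : 0 < a) (ha : ∀ x, a ≤ g x) (hb : ∀ x, g x ≤ b) (hη : 0 < η)
    (hkη : ((b - a) / 2) ^ 2 ≤ k * (a * η) ^ 2) :
    Real.log (∫ x, g x ∂μ) - Real.log (1 + η)
        ≤ ∫ ω : Fin k → α, Real.log ((k : ℝ)⁻¹ * ∑ i, g (ω i)) ∂(Measure.pi fun _ => μ) ∧
      ∫ ω : Fin k → α, Real.log ((k : ℝ)⁻¹ * ∑ i, g (ω i)) ∂(Measure.pi fun _ => μ)
        ≤ Real.log (∫ x, g x ∂μ) := by
  have hk' : (0 : ℝ) < k := by positivity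
  have hint : Integrable g μ := integrable_of_measurable_of_bounds hg ha hb
  set P : Measure (Fin k → α) := Measure.pi fun _ => μ with hP
  set Z : (Fin k → α) → ℝ := fun ω => (k : ℝ)⁻¹ * ∑ i, g (ω i) with hZdef
  set c : ℝ := ∫ x, g x ∂μ with hc
  have hc0 : 0 < c := ha0.trans_le (const_le_integral hint ha)
  have hZm : Measurable Z := by fun_prop
  have hZa (ω : Fin k → α) : a ≤ Z ω := le_mean_of_le hk fun i => ha _
  have hZb (ω : Fin k → α) : Z ω ≤ b := mean_le_of_le hk fun i => hb _
  have hZi : Integrable Z P := integrable_of_measurable_of_bounds hZm hZa hZb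
  have hEZ : ∫ ω, Z ω ∂P = c := integral_mean_pi hk hint
  have hlogi : Integrable (fun ω => Real.log (Z ω)) P :=
    integrable_of_measurable_of_bounds (hZm.log)
      (fun ω => Real.log_le_log ha0 (hZa ω))
      (fun ω => Real.log_le_log (ha0.trans_le (hZa ω)) (hZb ω))
  constructor
  · have hsqm : Measurable fun ω => (Z ω - c) ^ 2 := by fun_prop
    have hsqi : Integrable (fun ω => (Z ω - c) ^ 2) P := by
      refine integrable_of_measurable_of_bounds (hi := (|b| + |c| + |a|) ^ 2) hsqm
        (fun ω => sq_nonneg _) fun ω => ?_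
      rw [sq_le_sq, abs_of_nonneg (by positivity : 0 ≤ |b| + |c| + |a|), abs_le]
      have := hZa ω
      have := hZb ω
      have := neg_abs_le a
      have := le_abs_self b
      have := le_abs_self c
      have := neg_abs_le c
      have := abs_nonneg b
      have := abs_nonneg a
      constructor <;> linarith
    -- After `log u ≤ u - 1` with `u = c/((1+η)Z)`, the AM-GM inequality with weight `aη` bounds `c
    -- - Z` by a quadratic in `Z - c`, and `Z ≥ a` frees the denominator. The right side has
    -- nonpositive mean as soon as `E(Z-c)² ≤ (aη)²`.
    have hpt (ω : Fin k → α) : Real.log c - Real.log (1 + η) - Real.log (Z ω)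
        ≤ ((Z ω - c) ^ 2 / (2 * (a * η)) + a * η / 2 - a * η) / (a * (1 + η)) := by
      have hz : 0 < Z ω := ha0.trans_le (hZa ω)
      have h1 : Real.log (c / ((1 + η) * Z ω)) ≤ c / ((1 + η) * Z ω) - 1 :=
        Real.log_le_sub_one_of_pos (by positivity)
      rw [Real.log_div hc0.ne' (by positivity), Real.log_mul (by positivity) hz.ne'] at h1
      have h2 : c ≤ Z ω + ((Z ω - c) ^ 2 / (2 * (a * η)) + a * η / 2) := by
        have h3 : 0 ≤ (Z ω - c + a * η) ^ 2 / (2 * (a * η)) := by positivity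
        have h4 : (Z ω - c + a * η) ^ 2 / (2 * (a * η))
            = (Z ω - c) ^ 2 / (2 * (a * η)) + a * η / 2 + (Z ω - c) := by
          field_simp
          ring
        linarith
      set w : ℝ := (Z ω - c) ^ 2 / (2 * (a * η)) + a * η / 2 with hw
      have hw0 : 0 ≤ w := by positivity
      have h5 : c / ((1 + η) * Z ω) - 1 ≤ (w - a * η) / (a * (1 + η)) := by
        have h6 : c / ((1 + η) * Z ω) ≤ (Z ω + w) / ((1 + η) * Z ω) := by gcongr
        have h7 : (Z ω + w) / ((1 + η) * Z ω) = 1 / (1 + η) + w / ((1 + η) * Z ω) := by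
          field_simp
        have h8 : w / ((1 + η) * Z ω) ≤ w / ((1 + η) * a) := by gcongr; exact hZa ω
        have h9 : (w - a * η) / (a * (1 + η)) = 1 / (1 + η) + w / ((1 + η) * a) - 1 := by
          field_simp
          ring
        linarith
      linarith
    have hsq : ∫ ω, (Z ω - c) ^ 2 ∂P ≤ (a * η) ^ 2 := by
      refine (integral_sq_mean_sub_le hk hg ha hb).trans ?_
      rwa [inv_mul_le_iff₀ hk']
    have hR : Integrable (fun ω =>
        ((Z ω - c) ^ 2 / (2 * (a * η)) + a * η / 2 - a * η) / (a * (1 + η))) P :=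
      (((hsqi.div_const _).add (integrable_const _)).sub (integrable_const _)).div_const _
    have h := integral_mono ((integrable_const _).sub hlogi) hR hpt
    have hd : Integrable (fun ω => (Z ω - c) ^ 2 / (2 * (a * η))) P := hsqi.div_const _
    have hd' : Integrable (fun ω => (Z ω - c) ^ 2 / (2 * (a * η)) + a * η / 2) P :=
      hd.add (integrable_const _)
    rw [integral_div, integral_sub hd' (integrable_const _), integral_add hd (integrable_const _),
      integral_div] at h
    have h' : ∫ ω, (Real.log c - Real.log (1 + η) - Real.log (Z ω)) ∂P
        = Real.log c - Real.log (1 + η) - ∫ ω, Real.log (Z ω) ∂P := by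
      rw [integral_sub (integrable_const _) hlogi]; simp
    have h'' : ((∫ ω, (Z ω - c) ^ 2 ∂P) / (2 * (a * η)) + a * η / 2 - a * η) / (a * (1 + η))
        ≤ 0 := by
      refine div_nonpos_of_nonpos_of_nonneg ?_ (by positivity)
      have : (∫ ω, (Z ω - c) ^ 2 ∂P) / (2 * (a * η)) ≤ a * η / 2 := by
        rw [div_le_iff₀ (by positivity)]
        linarith [hsq]
      linarith
    simp only [integral_const, probReal_univ, one_smul] at h
    have h3 := h'.symm.le.trans h
    linarith
  -- Jensen's inequality through the tangent of `log` at `c = E Z`.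
  · have hpt (ω : Fin k → α) : Real.log (Z ω) ≤ Real.log c + (Z ω / c - 1) := by
      have hz : 0 < Z ω := ha0.trans_le (hZa ω)
      have h1 := Real.log_le_sub_one_of_pos (div_pos hz hc0)
      rw [Real.log_div hz.ne' hc0.ne'] at h1
      linarith
    have hR : Integrable (fun ω => Z ω / c - 1) P := (hZi.div_const _).sub (integrable_const _)
    refine (integral_mono hlogi ((integrable_const _).add hR) hpt).trans ?_
    have h' : ∫ ω, (Real.log c + (Z ω / c - 1)) ∂P = Real.log c := by
      rw [integral_add (integrable_const _) hR, integral_sub (hZi.div_const _) (integrable_const _),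
        integral_div, hEZ, div_self hc0.ne']
      simp
    exact h'.le

/-- **Hoeffding's inequality**, one-sided, for the sample mean of a bounded function. -/
lemma measureReal_mean_ge_le {k : ℕ} (hk : 1 ≤ k) {f : α → ℝ} (hf : Measurable f) {lo R ε : ℝ}
    (hlo : ∀ x, lo ≤ f x) (hhi : ∀ x, f x ≤ lo + R) (hε : 0 ≤ ε) :
    (Measure.pi fun _ : Fin k => μ).real
      {ω | ε ≤ (k : ℝ)⁻¹ * ∑ i, f (ω i) - ∫ x, f x ∂μ} ≤ Real.exp (-(2 * k * ε ^ 2 / R ^ 2)) := by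
  have hk' : (0 : ℝ) < k := by positivity
  have hsub : HasSubgaussianMGF (fun x => f x - ∫ x, f x ∂μ) ((‖lo + R - lo‖₊ / 2) ^ 2) μ :=
    hasSubgaussianMGF_of_mem_Icc hf.aemeasurable (.of_forall fun x => ⟨hlo x, hhi x⟩)
  have hind := iIndepFun_pi (μ := fun _ : Fin k => μ) (X := fun _ x => f x - ∫ x, f x ∂μ)
    fun _ => (hf.sub_const _).aemeasurable
  have hsub' (i : Fin k) : HasSubgaussianMGF (fun ω : Fin k → α => f (ω i) - ∫ x, f x ∂μ)
      ((‖lo + R - lo‖₊ / 2) ^ 2) (Measure.pi fun _ => μ) := by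
    have h := measurePreserving_eval (fun _ : Fin k => μ) i
    refine HasSubgaussianMGF.of_map (Y := Function.eval i) (X := fun x => f x - ∫ x, f x ∂μ) h.measurable.aemeasurable ?_
    rw [h.map_eq]
    exact hsub
  have h := HasSubgaussianMGF.measure_sum_ge_le_of_iIndepFun hind (s := Finset.univ)
    (fun i _ => hsub' i) (mul_nonneg hk'.le hε)
  refine (le_of_eq ?_).trans (h.trans (le_of_eq ?_))
  · congr 1
    ext ω
    simp only [Set.mem_ofPred_eq, Finset.sum_sub_distrib, Finset.sum_const, Finset.card_univ,
      Fintype.card_fin, nsmul_eq_mul]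
    rw [← mul_le_mul_iff_right₀ hk', mul_sub, mul_inv_cancel_left₀ hk'.ne']
  · congr 1
    simp only [add_sub_cancel_left, Finset.sum_const, Finset.card_univ, Fintype.card_fin,
      nsmul_eq_mul, NNReal.coe_mul, NNReal.coe_pow, NNReal.coe_div, coe_nnnorm, Real.norm_eq_abs,
      NNReal.coe_natCast, NNReal.coe_ofNat, div_pow, sq_abs]
    rcases eq_or_ne R 0 with rfl | hR
    · simp
    · field_simp

lemma le_measureReal_mean_sub_le {k : ℕ} (hk : 1 ≤ k) {f : α → ℝ} (hf : Measurable f)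
    {lo R ε δ : ℝ} (hlo : ∀ x, lo ≤ f x) (hhi : ∀ x, f x ≤ lo + R) (hε : 0 < ε) (hδ : 0 < δ)
    (hkε : 1 / 2 * (R / ε) ^ 2 * Real.log (2 / δ) ≤ k) :
    1 - δ ≤ (Measure.pi fun _ : Fin k => μ).real
      {ω | |(k : ℝ)⁻¹ * ∑ i, f (ω i) - ∫ x, f x ∂μ| ≤ ε} := by
  have hk' : (0 : ℝ) < k := by positivity
  have hint : Integrable f μ := integrable_of_measurable_of_bounds hf hlo hhi
  -- For `R = 0` the Hoeffding bound reads `exp 0 = 1` by the convention for division by zero, so a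
  -- constant `f` is treated directly.
  rcases eq_or_ne R 0 with rfl | hR
  · have hc (x : α) : f x = lo := le_antisymm (by simpa using hhi x) (hlo x)
    have : {ω : Fin k → α | |(k : ℝ)⁻¹ * ∑ i, f (ω i) - ∫ x, f x ∂μ| ≤ ε} = Set.univ := by
      ext ω
      simp [hc, hk'.ne', hε.le]
    rw [this, probReal_univ]
    linarith
  have hexp : Real.exp (-(2 * k * ε ^ 2 / R ^ 2)) ≤ δ / 2 := by
    rw [← Real.le_log_iff_exp_le (by positivity), ← neg_le_neg_iff, neg_neg, ← Real.log_inv,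
      inv_div]
    have h1 : 1 / 2 * (R / ε) ^ 2 * Real.log (2 / δ) * (2 * ε ^ 2 / R ^ 2) = Real.log (2 / δ) := by
      field_simp
    rw [← h1]
    calc _ ≤ (k : ℝ) * (2 * ε ^ 2 / R ^ 2) := by gcongr
      _ = _ := by ring
  have hup := measureReal_mean_ge_le (μ := μ) hk hf hlo hhi hε.le
  have hdn := measureReal_mean_ge_le (μ := μ) hk (f := fun x => -f x) hf.neg (lo := -(lo + R))
    (R := R) (fun x => neg_le_neg (hhi x)) (fun x => by linarith [hlo x]) hε.le
  simp only [Finset.sum_neg_distrib, integral_neg, mul_neg] at hdn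
  have hcov : (Set.univ : Set (Fin k → α)) ⊆
      {ω | |(k : ℝ)⁻¹ * ∑ i, f (ω i) - ∫ x, f x ∂μ| ≤ ε} ∪
        ({ω | ε ≤ (k : ℝ)⁻¹ * ∑ i, f (ω i) - ∫ x, f x ∂μ} ∪
          {ω | ε ≤ -((k : ℝ)⁻¹ * ∑ i, f (ω i)) - -∫ x, f x ∂μ}) := by
    intro ω _
    simp only [Set.mem_union, Set.mem_ofPred_eq, abs_le]
    by_contra! h
    exact absurd (h.1 (by linarith [h.2.2])) (by linarith [h.2.1])
  have h1 := measureReal_mono (μ := Measure.pi fun _ : Fin k => μ) hcov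
  rw [probReal_univ] at h1
  have h2 := h1.trans ((measureReal_union_le _ _).trans (add_le_add_right
    (measureReal_union_le _ _) _))
  linarith

end sampleMean

namespace MDP

variable {M : MDP S A} {Q : S.Pt × A.Pt → ℝ} {lo R : ℝ}

/-! ### The sampled soft values -/

lemma iid_apply {α β : Type*} [MeasurableSpace α] [MeasurableSpace β] (k : ℕ) (κ : Kernel α β)
    [IsMarkovKernel κ] (a : α) : iid k κ a = Measure.pi fun _ => κ a := rfl

lemma exp_mul_mem (M : MDP S A) (hlo : ∀ x, lo ≤ Q x) (hhi : ∀ x, Q x ≤ lo + R)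
    (x : S.Pt × A.Pt) : Real.exp (M.beta * lo) ≤ Real.exp (M.beta * Q x) ∧
      Real.exp (M.beta * Q x) ≤ Real.exp (M.beta * (lo + R)) := by
  have := M.beta_pos
  constructor <;> gcongr
  · exact hlo x
  · exact hhi x

lemma vHat_mem (hlo : ∀ x, lo ≤ Q x) (hhi : ∀ x, Q x ≤ lo + R) {nA : ℕ} (hnA : 1 ≤ nA)
    (s : S.Pt) (a : Fin nA → A.Pt) : lo ≤ M.vHat Q s a ∧ M.vHat Q s a ≤ lo + R := by
  have hb := M.beta_pos
  have h1 := le_mean_of_le hnA fun i => (exp_mul_mem M hlo hhi (s, a i)).1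
  have h2 := mean_le_of_le hnA fun i => (exp_mul_mem M hlo hhi (s, a i)).2
  unfold vHat
  rw [le_inv_mul_iff₀ hb, inv_mul_le_iff₀ hb,
    Real.le_log_iff_exp_le ((Real.exp_pos _).trans_le h1),
    Real.log_le_iff_le_exp ((Real.exp_pos _).trans_le h1)]
  exact ⟨h1, h2⟩

lemma measurable_vHat (hQ : Measurable Q) {nA : ℕ} :
    Measurable fun x : S.Pt × (Fin nA → A.Pt) => M.vHat Q x.1 x.2 := by
  unfold vHat
  fun_prop

lemma measurable_meanVHat (hQ : Measurable Q) {nS nA : ℕ} :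
    Measurable fun ω : NextSamples S A nS nA => M.meanVHat Q ω := by
  have h := measurable_vHat (M := M) hQ (nA := nA)
  unfold meanVHat
  exact (Finset.measurable_sum _ fun i _ => h.comp (measurable_pi_apply i)).const_mul _

/-- The choice `η = exp(βε) - 1` makes the bias `β⁻¹ log(1+η)` equal to `ε`; the common factor
`exp(β lo)` of all values of `exp(βQ)` cancels from the sample size condition. -/
lemma integral_vHat_mem (hQ : Measurable Q) (hlo : ∀ x, lo ≤ Q x) (hhi : ∀ x, Q x ≤ lo + R)
    {nA : ℕ} (hnA : 1 ≤ nA) {ε : ℝ} (hε : 0 < ε)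
    (hnε : (Real.exp (M.beta * R) - 1) ^ 2 / 4 ≤ nA * (Real.exp (M.beta * ε) - 1) ^ 2)
    (s : S.Pt) :
    M.softValue Q s - ε ≤ ∫ a, M.vHat Q s a ∂iid nA M.prior.kernel s ∧
      ∫ a, M.vHat Q s a ∂iid nA M.prior.kernel s ≤ M.softValue Q s := by
  have hb := M.beta_pos
  have hη : 0 < Real.exp (M.beta * ε) - 1 := by
    rw [sub_pos, Real.one_lt_exp_iff]; positivity
  have hbud : ((Real.exp (M.beta * (lo + R)) - Real.exp (M.beta * lo)) / 2) ^ 2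
      ≤ nA * (Real.exp (M.beta * lo) * (Real.exp (M.beta * ε) - 1)) ^ 2 := by
    rw [mul_add, Real.exp_add]
    calc _ = Real.exp (M.beta * lo) ^ 2 * ((Real.exp (M.beta * R) - 1) ^ 2 / 4) := by ring
      _ ≤ Real.exp (M.beta * lo) ^ 2 * (nA * (Real.exp (M.beta * ε) - 1) ^ 2) := by gcongr
      _ = _ := by ring
  obtain ⟨h1, h2⟩ := integral_log_mean_mem (μ := M.prior.kernel s) hnA
    (g := fun a => Real.exp (M.beta * Q (s, a))) (by fun_prop) (Real.exp_pos _)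
    (fun a => (exp_mul_mem M hlo hhi (s, a)).1) (fun a => (exp_mul_mem M hlo hhi (s, a)).2) hη hbud
  rw [add_sub_cancel, Real.log_exp] at h1
  unfold vHat softValue
  rw [integral_const_mul, iid_apply]
  constructor
  · calc _ = M.beta⁻¹ * (Real.log (∫ a, Real.exp (M.beta * Q (s, a)) ∂M.prior.kernel s)
          - M.beta * ε) := by field_simp
      _ ≤ _ := by gcongr
  · gcongr

/-- The empirical mean of the sampled soft values is close to the expected soft value of the next
state, with high probability. -/
theorem le_nextLaw_meanVHat (hQ : Measurable Q) (hlo : ∀ x, lo ≤ Q x) (hhi : ∀ x, Q x ≤ lo + R)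
    {nS nA : ℕ} (hnS : 1 ≤ nS) (hnA : 1 ≤ nA) {ε₂ ε₃ δ : ℝ} (hε₂ : 0 < ε₂) (hε₃ : 0 < ε₃)
    (hδ : 0 < δ) (hS : 1 / 2 * (R / ε₂) ^ 2 * Real.log (2 / δ) ≤ nS)
    (hA : (Real.exp (M.beta * R) - 1) ^ 2 / 4 ≤ nA * (Real.exp (M.beta * ε₃) - 1) ^ 2)
    (x : S.Pt × A.Pt) :
    1 - δ ≤ (M.nextLaw nS nA x).real
      {ω | |M.meanVHat Q ω - M.nextValue Q x| ≤ ε₂ + ε₃} := by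
  set κ := M.trans ⊗ₖ Kernel.prodMkLeft (S.Pt × A.Pt) (iid nA M.prior.kernel) with hκ
  have hm := measurable_vHat (M := M) hQ (nA := nA)
  have h := le_measureReal_mean_sub_le (μ := κ x) hnS hm
    (fun y => (vHat_mem hlo hhi hnA y.1 y.2).1) (fun y => (vHat_mem hlo hhi hnA y.1 y.2).2)
    hε₂ hδ hS
  refine h.trans (measureReal_mono fun ω hω => ?_)
  have hint : Integrable (fun y : S.Pt × (Fin nA → A.Pt) => M.vHat Q y.1 y.2) (κ x) :=
    integrable_of_measurable_of_bounds hm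
      (fun y => (vHat_mem hlo hhi hnA y.1 y.2).1) (fun y => (vHat_mem hlo hhi hnA y.1 y.2).2)
  have hE : ∫ y, M.vHat Q y.1 y.2 ∂κ x
      = ∫ s, ∫ a, M.vHat Q s a ∂iid nA M.prior.kernel s ∂M.trans x := by
    rw [hκ, ProbabilityTheory.integral_compProd hint]
    rfl
  have hi : Integrable (fun s => ∫ a, M.vHat Q s a ∂iid nA M.prior.kernel s) (M.trans x) :=
    hint.integral_compProd
  have hV := integrable_softValue (M := M) hQ hlo hhi (M.trans x)
  have h1 : M.nextValue Q x - ε₃ ≤ ∫ y, M.vHat Q y.1 y.2 ∂κ x := by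
    rw [hE]
    have := integral_mono (hV.sub (integrable_const ε₃)) hi
      fun s => (integral_vHat_mem hQ hlo hhi hnA hε₃ hA s).1
    simp only [Pi.sub_apply] at this
    rw [integral_sub hV (integrable_const _)] at this
    simpa [nextValue] using this
  have h2 : ∫ y, M.vHat Q y.1 y.2 ∂κ x ≤ M.nextValue Q x := by
    rw [hE]
    exact integral_mono hi hV fun s => (integral_vHat_mem hQ hlo hhi hnA hε₃ hA s).2
  simp only [Set.mem_ofPred_eq, abs_le] at hω ⊢
  unfold meanVHat
  constructor <;> linarith [hω.1, hω.2]

end MDP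

/-! ### The probability of a level set of a Lipschitz function -/

lemma Domain.lebesgue_apply {k : ℕ} (D : Domain k) (T : Set D.Pt) :
    D.lebesgue T = volume (Subtype.val '' T) :=
  comap_subtype_coe_apply D.measurableSet _ T

instance {k : ℕ} (D : Domain k) : PreconnectedSpace D.Pt :=
  Subtype.preconnectedSpace D.convex.isPreconnected

/-- The homothety centred at `y` maps the convex domain into itself for `t ≤ 1` and scales volume by
`t^k`. -/
lemma Domain.ofReal_pow_le_unif {k : ℕ} (D : Domain k) (y : D.Pt) {t : ℝ} (ht0 : 0 ≤ t)
    (ht1 : t ≤ 1) :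
    ENNReal.ofReal (t ^ k) ≤ D.unif {z : D.Pt | ∃ w : D.Pt,
      (z : EuclideanSpace ℝ (Fin k)) = AffineMap.homothety (y : EuclideanSpace ℝ (Fin k)) t w.1} := by
  have hu : D.lebesgue Set.univ = volume D.carrier := by
    rw [D.lebesgue_apply]; simp
  have htop : volume D.carrier ≠ ⊤ := D.isBounded.measure_lt_top.ne
  have hvol : ENNReal.ofReal (t ^ k) * volume D.carrier ≤ D.lebesgue {z : D.Pt | ∃ w : D.Pt,
      (z : EuclideanSpace ℝ (Fin k)) = AffineMap.homothety (y : EuclideanSpace ℝ (Fin k)) t w.1} := by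
    have h := Measure.addHaar_image_homothety (volume : Measure (EuclideanSpace ℝ (Fin k)))
      (y : EuclideanSpace ℝ (Fin k)) t D.carrier
    rw [finrank_euclideanSpace_fin, abs_of_nonneg (pow_nonneg ht0 k)] at h
    rw [← h, D.lebesgue_apply]
    refine measure_mono ?_
    rintro _ ⟨w, hw, rfl⟩
    have hmem : AffineMap.homothety (y : EuclideanSpace ℝ (Fin k)) t w ∈ D.carrier := by
      rw [AffineMap.homothety_eq_lineMap]
      exact D.convex.lineMap_mem y.2 hw ⟨ht0, ht1⟩
    exact ⟨⟨_, hmem⟩, ⟨⟨w, hw⟩, rfl⟩, rfl⟩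
  rw [Domain.unif, Measure.smul_apply, smul_eq_mul, hu]
  calc ENNReal.ofReal (t ^ k)
      = (volume D.carrier)⁻¹ * (ENNReal.ofReal (t ^ k) * volume D.carrier) := by
        rw [mul_comm, mul_assoc, ENNReal.mul_inv_cancel D.volume_ne_zero htop, mul_one]
    _ ≤ _ := by gcongr

lemma saDist_homothety (q : ℝ≥0∞) [Fact (1 ≤ q)] {y z w : S.Pt × A.Pt} {t : ℝ} (ht : 0 ≤ t)
    (h1 : (z.1 : EuclideanSpace ℝ (Fin m)) = AffineMap.homothety y.1.1 t w.1.1)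
    (h2 : (z.2 : EuclideanSpace ℝ (Fin n)) = AffineMap.homothety y.2.1 t w.2.1) :
    saDist q z y = t * saDist q w y := by
  simp only [saDist, dist_eq_norm, ← WithLp.toLp_sub]
  have h : ((z.1 : EuclideanSpace ℝ (Fin m)), (z.2 : EuclideanSpace ℝ (Fin n)))
      - ((y.1 : EuclideanSpace ℝ (Fin m)), (y.2 : EuclideanSpace ℝ (Fin n)))
      = t • (((w.1 : EuclideanSpace ℝ (Fin m)), (w.2 : EuclideanSpace ℝ (Fin n)))
        - ((y.1 : EuclideanSpace ℝ (Fin m)), (y.2 : EuclideanSpace ℝ (Fin n)))) := by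
    simp [h1, h2, AffineMap.homothety_apply]
  rw [h, WithLp.toLp_smul, norm_smul, Real.norm_of_nonneg ht]

/-- The level `c` may be an extremum that is not attained, as the domain need not be closed; hence a
point near the level and not on it. -/
lemma exists_abs_sub_lt {X : Type*} [TopologicalSpace X] [PreconnectedSpace X] [Nonempty X]
    {f : X → ℝ} (hf : Continuous f) {c η : ℝ} (h1 : (⨅ y, f y) ≤ c) (h2 : c ≤ ⨆ y, f y)
    (hη : 0 < η) : ∃ y, |f y - c| < η := by
  obtain ⟨y₁, hy₁⟩ := exists_lt_of_ciInf_lt (h1.trans_lt (lt_add_of_pos_right c hη))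
  obtain ⟨y₂, hy₂⟩ := exists_lt_of_lt_ciSup ((sub_lt_self c hη).trans_le h2)
  by_cases h3 : c - η < f y₁
  · exact ⟨y₁, abs_lt.2 ⟨by linarith, by linarith⟩⟩
  by_cases h4 : f y₂ < c + η
  · exact ⟨y₂, abs_lt.2 ⟨by linarith, by linarith⟩⟩
  obtain ⟨y, hy⟩ := mem_range_of_exists_le_of_exists_ge hf
    (⟨y₁, by linarith⟩ : ∃ a, f a ≤ c) ⟨y₂, by linarith⟩
  exact ⟨y, by simpa [hy] using hη⟩

section level

variable {q : ℝ≥0∞} [Fact (1 ≤ q)] {f : S.Pt × A.Pt → ℝ} {L c ε : ℝ}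

lemma pow_le_measureReal_level [Nonempty (S.Pt × A.Pt)] (hL : 0 ≤ L)
    (hf : ∀ x y, |f x - f y| ≤ L * saDist q x y)
    (h1 : (⨅ y, f y) ≤ c) (h2 : c ≤ ⨆ y, f y) {t : ℝ} (ht0 : 0 ≤ t) (ht1 : t ≤ 1)
    (ht : t * (L * saDiam q S A) < ε) :
    t ^ (m + n) ≤ (S.unif.prod A.unif).real {y | |f y - c| ≤ ε} := by
  -- The shrunken copy moves `f` by at most `t L diam`; what remains of `ε` is left for the distance
  -- of `f y` from `c`.
  obtain ⟨y, hy⟩ := exists_abs_sub_lt (continuous_of_saDist_le q hf) h1 h2 (sub_pos.2 ht)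
  have hsub : {z : S.Pt | ∃ w : S.Pt, (z : EuclideanSpace ℝ (Fin m))
        = AffineMap.homothety (y.1 : EuclideanSpace ℝ (Fin m)) t w.1} ×ˢ
      {z : A.Pt | ∃ w : A.Pt, (z : EuclideanSpace ℝ (Fin n))
        = AffineMap.homothety (y.2 : EuclideanSpace ℝ (Fin n)) t w.1}
      ⊆ {z | |f z - c| ≤ ε} := by
    rintro z ⟨⟨w₁, hw₁⟩, ⟨w₂, hw₂⟩⟩
    have h3 := hf z y
    rw [saDist_homothety q (w := (w₁, w₂)) ht0 hw₁ hw₂] at h3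
    have h4 : L * (t * saDist q (w₁, w₂) y) ≤ t * (L * saDiam q S A) := by
      calc _ = t * (L * saDist q (w₁, w₂) y) := by ring
        _ ≤ _ := by gcongr; exact saDist_le_saDiam q _ _
    have h5 := abs_sub_le (f z) (f y) c
    rw [Set.mem_ofPred_eq]
    linarith
  rw [measureReal_def, ← ENNReal.ofReal_le_iff_le_toReal (measure_ne_top _ _)]
  refine le_trans ?_ (measure_mono hsub)
  rw [Measure.prod_prod, pow_add, ENNReal.ofReal_mul (pow_nonneg ht0 m)]
  exact mul_le_mul' (S.ofReal_pow_le_unif y.1 ht0 ht1) (A.ofReal_pow_le_unif y.2 ht0 ht1)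

/-- A batch of the prescribed size misses a level set of a Lipschitz function with probability
at most `δ`. -/
lemma one_sub_level_pow_le [Nonempty (S.Pt × A.Pt)] (hL : 0 ≤ L)
    (hf : ∀ x y, |f x - f y| ≤ L * saDist q x y)
    (h1 : (⨅ y, f y) ≤ c) (h2 : c ≤ ⨆ y, f y) (hε : 0 < ε) {δ : ℝ} (hδ : 0 < δ) {N : ℕ}
    (hN : 1 ≤ N)
    (hbudget : (L * saDiam q S A / ε) ^ (m + n) * Real.log (1 / δ) ≤ N) :
    (1 - (S.unif.prod A.unif).real {y | |f y - c| ≤ ε}) ^ N ≤ δ := by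
  set p := (S.unif.prod A.unif).real {y | |f y - c| ≤ ε} with hp
  have hp1 : p ≤ 1 := measureReal_le_one
  set D := L * saDiam q S A with hD
  -- If `D < ε` the level set has full measure, and `N ≥ 1` gives `0 ^ N = 0`. Otherwise `t = ε/D`
  -- is the natural ratio but violates the strict inequality, so it is approached from below.
  rcases lt_or_ge D ε with hlt | hge
  · have h3 := pow_le_measureReal_level hL hf h1 h2 zero_le_one le_rfl (by simpa using hlt)
    rw [one_pow, ← hp] at h3
    rw [le_antisymm hp1 h3, sub_self, zero_pow (by omega)]
    exact hδ.le
  · have hD0 : 0 < D := hε.trans_le hge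
    have ht0 : 0 < ε / D := div_pos hε hD0
    have h3 : (ε / D) ^ (m + n) ≤ p := by
      have hlim : Filter.Tendsto (fun t : ℝ => t ^ (m + n)) (nhdsWithin (ε / D) (Set.Iio (ε / D)))
          (nhds ((ε / D) ^ (m + n))) :=
        (continuous_pow (m + n)).continuousWithinAt
      refine le_of_tendsto hlim ?_
      filter_upwards [self_mem_nhdsWithin, mem_nhdsWithin_of_mem_nhds (Ioi_mem_nhds ht0)]
        with t ht ht'
      refine pow_le_measureReal_level hL hf h1 h2 (le_of_lt ht') ?_ ?_
      · exact (le_of_lt ht).trans ((div_le_one hD0).2 hge)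
      · exact (lt_div_iff₀ hD0).1 ht
    have h4 : Real.log (1 / δ) ≤ N * p := by
      have h5 : (D / ε) ^ (m + n) * (ε / D) ^ (m + n) = 1 := by
        rw [← mul_pow, div_mul_div_cancel₀ hε.ne', div_self hD0.ne', one_pow]
      calc Real.log (1 / δ)
          = (D / ε) ^ (m + n) * Real.log (1 / δ) * (ε / D) ^ (m + n) := by
            rw [mul_right_comm, h5, one_mul]
        _ ≤ N * (ε / D) ^ (m + n) := by gcongr
        _ ≤ N * p := by gcongr
    calc (1 - p) ^ N ≤ Real.exp (-p) ^ N := by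
          have h5 := Real.one_sub_le_exp_neg p
          have h6 : 0 ≤ 1 - p := sub_nonneg.2 hp1
          gcongr
      _ = Real.exp (-(N * p)) := by rw [← Real.exp_nat_mul, mul_neg]
      _ ≤ Real.exp (-Real.log (1 / δ)) := by gcongr
      _ = δ := by rw [Real.log_div one_ne_zero hδ.ne', Real.log_one, zero_sub, neg_neg,
        Real.exp_log hδ]

end level

/-! ### Independent trials -/

lemma one_sub_pow_le_pi_exists {α : Type*} [MeasurableSpace α] (μ : Measure α)
    [IsProbabilityMeasure μ] {G : Set α} (hG : MeasurableSet G) (N : ℕ) :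
    1 - (1 - μ.real G) ^ N ≤ (Measure.pi fun _ : Fin N => μ).real {ω | ∃ j, ω j ∈ G} := by
  have h1 : (Set.univ : Set (Fin N → α)) ⊆
      {ω | ∃ j, ω j ∈ G} ∪ Set.pi Set.univ fun _ => Gᶜ := by
    intro ω _
    by_cases h : ∃ j, ω j ∈ G
    · exact Or.inl h
    · exact Or.inr fun j _ hj => h ⟨j, hj⟩
  have h2 : (Measure.pi fun _ : Fin N => μ).real (Set.pi Set.univ fun _ => Gᶜ)
      = (1 - μ.real G) ^ N := by
    rw [measureReal_def, Measure.pi_pi, ENNReal.toReal_prod, ← measureReal_def,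
      probReal_compl_eq_one_sub hG]
    simp
  have h3 := (measureReal_mono (μ := Measure.pi fun _ : Fin N => μ) h1).trans
    (measureReal_union_le _ _)
  rw [probReal_univ, h2] at h3
  linarith

/-- Convexity of `x ^ N` at `(1-δ)(1-p) + δ·1`. Inaccurate estimates in the batch thus cost `δ`
once, not `N` times. -/
lemma one_sub_mul_pow_le {p δ : ℝ} (hp1 : p ≤ 1) (hδ0 : 0 ≤ δ) (hδ1 : δ ≤ 1)
    (N : ℕ) : (1 - p * (1 - δ)) ^ N ≤ (1 - p) ^ N + δ := by
  have h := (convexOn_pow (𝕜 := ℝ) N).2 (x := 1 - p) (y := 1) (sub_nonneg.2 hp1)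
    (zero_le_one (α := ℝ)) (sub_nonneg.2 hδ1) hδ0 (sub_add_cancel 1 δ)
  simp only [smul_eq_mul, one_pow, mul_one] at h
  have h1 : 0 ≤ δ * (1 - p) ^ N := mul_nonneg hδ0 (pow_nonneg (sub_nonneg.2 hp1) N)
  calc (1 - p * (1 - δ)) ^ N = ((1 - δ) * (1 - p) + δ) ^ N := by ring
    _ ≤ _ := h
    _ ≤ _ := by linarith

lemma mul_le_compProd_real {α β : Type*} [MeasurableSpace α] [MeasurableSpace β] (ν : Measure α)
    [IsProbabilityMeasure ν] (κ : Kernel α β) [IsMarkovKernel κ] {K : Set α} {G : Set (α × β)}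
    (hK : MeasurableSet K) (hG : MeasurableSet G) {r : ℝ}
    (h : ∀ a ∈ K, r ≤ (κ a).real (Prod.mk a ⁻¹' G)) :
    ν.real K * r ≤ (ν ⊗ₘ κ).real G := by
  rw [measureReal_def (ν ⊗ₘ κ), ← ENNReal.ofReal_le_iff_le_toReal (measure_ne_top _ _),
    Measure.compProd_apply hG, ENNReal.ofReal_mul measureReal_nonneg,
    ofReal_measureReal]
  calc ν K * ENNReal.ofReal r = ∫⁻ a, K.indicator (fun _ => ENNReal.ofReal r) a ∂ν := by
        rw [lintegral_indicator_const hK, mul_comm]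
    _ ≤ _ := by
        refine lintegral_mono fun a => ?_
        by_cases ha : a ∈ K
        · rw [Set.indicator_of_mem ha]
          exact ENNReal.ofReal_le_of_le_toReal (h a ha)
        · rw [Set.indicator_of_notMem ha]
          exact zero_le

/-! ### Deterministic consequences of a good sample -/

namespace MDP

variable {M : MDP S A} {Q : S.Pt × A.Pt → ℝ}

/-- If the estimate at `x` is accurate to `e`, and some batch element has an accurate estimate and a
Bellman gap close to the level `c` that determines the optimal value, then both bounds hold. -/
lemma bounds_of_good_sample {N nS nA : ℕ} {x : S.Pt × A.Pt} {c ε e : ℝ}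
    (hc : M.optimalQ x = M.reward x + M.disc * (M.nextValue Q x + c / (1 - M.disc)))
    (ω : NextSamples S A nS nA × BatchSamples S A N nS nA)
    (hx : |M.meanVHat Q ω.1 - M.nextValue Q x| ≤ e) (j : Fin N)
    (hj : |M.bellmanGap Q (ω.2 j).1 - c| ≤ ε)
    (hj' : |M.meanVHat Q (ω.2 j).2 - M.nextValue Q (ω.2 j).1| ≤ e) :
    M.lowerBound Q (ε + e) x ω ≤ M.optimalQ x ∧ M.optimalQ x ≤ M.upperBound Q (ε + e) x ω := by
  have hγ0 := M.disc_nonneg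
  have hγ : 0 < 1 - M.disc := sub_pos.2 M.disc_lt_one
  have hinf : (⨅ j, M.deltaHat Q (ω.2 j).1 (ω.2 j).2) ≤ M.deltaHat Q (ω.2 j).1 (ω.2 j).2 :=
    ciInf_le (Set.finite_range _).bddBelow j
  have hsup : M.deltaHat Q (ω.2 j).1 (ω.2 j).2 ≤ ⨆ j, M.deltaHat Q (ω.2 j).1 (ω.2 j).2 :=
    le_ciSup (f := fun j => M.deltaHat Q (ω.2 j).1 (ω.2 j).2) (Set.finite_range _).bddAbove j
  have hd : M.deltaHat Q (ω.2 j).1 (ω.2 j).2 = M.bellmanGap Q (ω.2 j).1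
      + M.disc * (M.meanVHat Q (ω.2 j).2 - M.nextValue Q (ω.2 j).1) := by
    unfold deltaHat bellmanGap; ring
  rw [abs_le] at hx hj hj'
  have h1 := mul_le_mul_of_nonneg_left hj'.1 hγ0
  have h2 := mul_le_mul_of_nonneg_left hj'.2 hγ0
  have hsplit (u : ℝ) : u / (1 - M.disc) * (1 - M.disc) = u := div_mul_cancel₀ u hγ.ne'
  rw [hc]
  unfold lowerBound upperBound
  constructor
  · refine add_le_add le_rfl (mul_le_mul_of_nonneg_left ?_ hγ0)
    -- After multiplication by `1-γ`, the estimate at `x` costs `(1-γ)e` and the one at the batch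
    -- element `γe`, together exactly `e`.
    rw [← mul_le_mul_iff_left₀ hγ, add_mul, add_mul, hsplit, hsplit]
    have h3 := mul_le_mul_of_nonneg_right hx.2 hγ.le
    linarith
  · refine add_le_add le_rfl (mul_le_mul_of_nonneg_left ?_ hγ0)
    rw [← mul_le_mul_iff_left₀ hγ, add_mul, add_mul, hsplit, hsplit]
    have h3 := mul_le_mul_of_nonneg_right hx.1 hγ.le
    linarith

end MDP

end SoftRL

end

/-! ### Combination of the good events -/

theorem theorem2 {m n : ℕ} {S : SoftRL.Domain m} {A : SoftRL.Domain n} (M : SoftRL.MDP S A)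
    (q : ℝ≥0∞) [Fact (1 ≤ q)]
    (Lr Lp Lk LQ Rmin Rmax : ℝ)
    (hM : M.IsLipschitz q Lr Lp) (hprior : M.IsLipschitzPrior Lk)
    (hr : ∀ x, Rmin ≤ M.reward x ∧ M.reward x ≤ Rmax)
    (Q : S.Pt × A.Pt → ℝ) (hLQ : 0 ≤ LQ)
    (hQ : ∀ x y, |Q x - Q y| ≤ LQ * SoftRL.saDist q x y)
    (hQ_range : ∀ x y, Q x - Q y ≤ M.horizon * (Rmax - Rmin))
    (ε₁ ε₂ ε₃ δ₁ δ₂ δ₃ : ℝ) (hε₁ : 0 < ε₁) (hε₂ : 0 < ε₂) (hε₃ : 0 < ε₃)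
    (hδ₁ : 0 < δ₁) (hδ₂ : 0 < δ₂) (hδ₃ : 0 < δ₃)
    (N nS nA : ℕ) (hN : 1 ≤ N) (hnS : 1 ≤ nS) (hnA : 1 ≤ nA)
    (hN_budget : (M.lipDelta Lr Lp Lk LQ * SoftRL.saDiam q S A / ε₁) ^ (m + n)
      * Real.log (1 / δ₁) ≤ N)
    (hnS_budget : 1 / 2 * (M.horizon * (Rmax - Rmin) / ε₂) ^ 2 * Real.log (2 / δ₂) ≤ nS)
    (hnA_budget : 1 / 2 * ((Real.exp (M.beta * M.horizon * (Rmax - Rmin)) - 1)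
      / (Real.exp (M.beta * ε₃) - 1)) ^ 2 * Real.log (2 / δ₃) ≤ nA)
    (x : S.Pt × A.Pt) :
    1 - δ₁ - 2 * δ₂ - 2 * δ₃ ≤ (M.sampleLaw N nS nA x).real
      {ω | M.lowerBound Q (ε₁ + ε₂ + ε₃) x ω ≤ M.optimalQ x ∧
        M.optimalQ x ≤ M.upperBound Q (ε₁ + ε₂ + ε₃) x ω} := by
  have hb := M.beta_pos
  have : IsMarkovKernel (M.nextLaw nS nA) := by
    unfold SoftRL.MDP.nextLaw; infer_instance
  have : IsProbabilityMeasure (M.batchLaw N nS nA) := by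
    unfold SoftRL.MDP.batchLaw; infer_instance
  have : IsProbabilityMeasure (M.sampleLaw N nS nA x) := by
    unfold SoftRL.MDP.sampleLaw; infer_instance
  -- Outside the trivial case `δ₂` and `δ₃` are below 1, as used later.
  by_cases htriv : 1 - δ₁ - 2 * δ₂ - 2 * δ₃ ≤ 0
  · exact htriv.trans measureReal_nonneg
  have hne : Nonempty (S.Pt × A.Pt) := ⟨x⟩
  have hQm : Measurable Q := (SoftRL.continuous_of_saDist_le q hQ).measurable
  have hrm : Measurable M.reward := (SoftRL.continuous_of_saDist_le q hM.reward_le).measurable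
  set R := M.horizon * (Rmax - Rmin) with hR
  have hbdd : BddBelow (Set.range Q) := ⟨Q x - R, by
    rintro _ ⟨y, rfl⟩
    linarith [hQ_range x y]⟩
  set lo := ⨅ y, Q y with hlo_def
  have hlo : ∀ y, lo ≤ Q y := ciInf_le hbdd
  have hhi : ∀ y, Q y ≤ lo + R := fun y => by
    have : Q y - R ≤ lo := le_ciInf fun z => by linarith [hQ_range y z]
    linarith
  have hnA' : (Real.exp (M.beta * R) - 1) ^ 2 / 4 ≤ nA * (Real.exp (M.beta * ε₃) - 1) ^ 2 := by
    have hη : 0 < Real.exp (M.beta * ε₃) - 1 := by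
      rw [sub_pos, Real.one_lt_exp_iff]; positivity
    -- The bias bound needs no confidence level: `log(2/δ₃) ≥ log 2 ≥ 1/2` already yields the sample
    -- size it requires.
    have hlog : 1 / 2 ≤ Real.log (2 / δ₃) := by
      have h1 : Real.log 2 ≤ Real.log (2 / δ₃) := by
        refine Real.log_le_log two_pos ?_
        rw [le_div_iff₀ hδ₃]
        linarith
      linarith [Real.log_two_gt_d9]
    rw [mul_assoc M.beta, ← hR] at hnA_budget
    calc (Real.exp (M.beta * R) - 1) ^ 2 / 4
        = 1 / 2 * ((Real.exp (M.beta * R) - 1) / (Real.exp (M.beta * ε₃) - 1)) ^ 2 * (1 / 2)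
          * (Real.exp (M.beta * ε₃) - 1) ^ 2 := by
          field_simp
          norm_num
      _ ≤ 1 / 2 * ((Real.exp (M.beta * R) - 1) / (Real.exp (M.beta * ε₃) - 1)) ^ 2
          * Real.log (2 / δ₃) * (Real.exp (M.beta * ε₃) - 1) ^ 2 := by gcongr
      _ ≤ _ := by gcongr
  have hest := SoftRL.MDP.le_nextLaw_meanVHat (M := M) hQm hlo hhi hnS hnA hε₂ hε₃ hδ₂
    hnS_budget hnA'
  have hgap := SoftRL.MDP.abs_bellmanGap_sub_le hM hprior hLQ hQ hlo hhi
  have hgm := SoftRL.MDP.measurable_bellmanGap (M := M) hrm hQm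
  have hL := SoftRL.MDP.lipDelta_nonneg hM hprior hLQ
  have hosc (y : S.Pt × A.Pt) : |M.bellmanGap Q y - M.bellmanGap Q x|
      ≤ M.lipDelta Lr Lp Lk LQ * SoftRL.saDiam q S A :=
    (hgap y x).trans (mul_le_mul_of_nonneg_left (SoftRL.saDist_le_saDiam q y x) hL)
  have hbelow : BddBelow (Set.range (M.bellmanGap Q)) := by
    refine ⟨M.bellmanGap Q x - M.lipDelta Lr Lp Lk LQ * SoftRL.saDiam q S A, ?_⟩
    rintro _ ⟨y, rfl⟩
    linarith [(abs_le.1 (hosc y)).1]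
  have habove : BddAbove (Set.range (M.bellmanGap Q)) := by
    refine ⟨M.bellmanGap Q x + M.lipDelta Lr Lp Lk LQ * SoftRL.saDiam q S A, ?_⟩
    rintro _ ⟨y, rfl⟩
    linarith [(abs_le.1 (hosc y)).2]
  obtain ⟨c, hc1, hc2, hc⟩ :=
    SoftRL.MDP.exists_optimalQ_eq hrm hQm hlo hhi hbelow habove x
  have hpow := SoftRL.one_sub_level_pow_le hL hgap hc1 hc2 hε₁ hδ₁ hN hN_budget
  set K : Set (S.Pt × A.Pt) := {y | |M.bellmanGap Q y - c| ≤ ε₁} with hK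
  -- A useful batch element: gap near the level `c` and accurate estimate. Its probability is at
  -- least `(1-δ₂)` times that of `K`.
  set G : Set ((S.Pt × A.Pt) × SoftRL.NextSamples S A nS nA) :=
    {y | |M.bellmanGap Q y.1 - c| ≤ ε₁ ∧ |M.meanVHat Q y.2 - M.nextValue Q y.1| ≤ ε₂ + ε₃}
    with hG
  have hmean := SoftRL.MDP.measurable_meanVHat (M := M) hQm (nS := nS) (nA := nA)
  have hnv := SoftRL.MDP.measurable_nextValue (M := M) hQm
  have hKm : MeasurableSet K :=
    measurableSet_le ((hgm.sub_const c).abs) measurable_const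
  have hGm : MeasurableSet G :=
    (measurableSet_le (((hgm.comp measurable_fst).sub_const c).abs) measurable_const).inter
      (measurableSet_le (((hmean.comp measurable_snd).sub (hnv.comp measurable_fst)).abs)
        measurable_const)
  have hGK := SoftRL.mul_le_compProd_real (S.unif.prod A.unif) (M.nextLaw nS nA) hKm hGm
    (r := 1 - δ₂) fun y hy => (hest y).trans (measureReal_mono fun ω hω => ⟨hy, hω⟩)
  set μ := (S.unif.prod A.unif) ⊗ₘ M.nextLaw nS nA with hμ
  have hbatch : 1 - δ₁ - δ₂ ≤ (M.batchLaw N nS nA).real {ω | ∃ j, ω j ∈ G} := by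
    refine le_trans ?_ (SoftRL.one_sub_pow_le_pi_exists μ hGm N)
    have h1 : (1 - μ.real G) ^ N ≤ (1 - (S.unif.prod A.unif).real K * (1 - δ₂)) ^ N := by
      have : 0 ≤ 1 - μ.real G := sub_nonneg.2 measureReal_le_one
      gcongr
    have h2 := SoftRL.one_sub_mul_pow_le (p := (S.unif.prod A.unif).real K) measureReal_le_one
      hδ₂.le (by linarith) N
    linarith
  have hsub : {ω | |M.meanVHat Q ω - M.nextValue Q x| ≤ ε₂ + ε₃} ×ˢ
      {ω : SoftRL.BatchSamples S A N nS nA | ∃ j, ω j ∈ G} ⊆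
      {ω | M.lowerBound Q (ε₁ + ε₂ + ε₃) x ω ≤ M.optimalQ x ∧
        M.optimalQ x ≤ M.upperBound Q (ε₁ + ε₂ + ε₃) x ω} := by
    rintro ω ⟨h1, j, hj⟩
    rw [add_assoc ε₁]
    exact SoftRL.MDP.bounds_of_good_sample hc ω h1 j hj.1 hj.2
  refine le_trans ?_ (measureReal_mono hsub)
  rw [SoftRL.MDP.sampleLaw, measureReal_prod_prod]
  -- The sample at `x` is independent of the batch, so the probabilities multiply.
  calc 1 - δ₁ - 2 * δ₂ - 2 * δ₃ ≤ (1 - δ₂) * (1 - δ₁ - δ₂) := by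
        nlinarith [mul_pos hδ₂ hδ₁, mul_pos hδ₂ hδ₂]
    _ ≤ _ := by
        gcongr
        · linarith
        · exact hest x
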